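/- **Setting.** Let $d\ge 1$, $b\ge 2$, $s\ge 0$ be integers. For $j=1,\dots,s$ let $X^{(j)}\subset\mathbb{R}^d$ be bounded with volume $1$, and let a recursive $b$-fold split of $X^{(j)}$ be given: Borel cells $X_{j,(k,t)}$ ($k\ge 0$, $0\le t<b^k$) with $X_{j,(0,0)}=X^{(j)}$, each level-$k$ cell being the union of its $b$ child cells $X_{j,(k,t,c)}$ ($0\le c<b$) of level $k+1$, which have equal volume and pairwise intersections of volume $0$. Suppose that for some $1\le C<\infty$ every level-$k$ cell has Euclidean diameter at most $Cb^{-k/d}$ (such splits are automatically convergent). Put $X^{1:s}=\prod_j X^{(j)}\subset\mathbb{R}^{ds}$ and let $f:X^{1:s}\to\mathbb{R}$. For $u\subseteq\{1,\dots,s\}$ let the ANOVA component be $$f_u(x)=\int_{\prod_{j\notin u}X^{(j)}}\Bigl(f(x)-\sum_{v\subsetneq u}f_v(x)\Bigr)\,dx_{-u}.$$ Let $\psi_{j,ktc}=b^{(k+1)/2}1_{X_{j,(k,t,c)}}-b^{(k-1)/2}1_{X_{j,(k,t)}}$, and for $\kappa=(k_j)_{j\in u}$ with $k_j\in\{0,1,\dots\}$,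 $\tau=(t_j)_{j\in u}$ with $0\le t_j<b^{k_j}$ and $\gamma=(c_j)_{j\in u}$ with $0\le c_j<b$, let $\psi_{u\kappa\tau\gamma}(x)=\prod_{j\in u}\psi_{j,k_jt_jc_j}(x_j)$, and $$\nu_{u\kappa}=\sum_{\tau}\sum_{\gamma}\langle f,\psi_{u\kappa\tau\gamma}\rangle\,\psi_{u\kappa\tau\gamma},\qquad \sigma_{u\kappa}^2=\int_{X^{1:s}}\nu_{u\kappa}(x)^2\,dx,\qquad |\kappa|=\sum_{j\in u}k_j .$$ Let $S_j=\{(j-1)d+1,\dots,jd\}$, $S_u=\bigcup_{j\in u}S_j$, and $\mathbb{S}_u=\{T\subseteq S_u: T\cap S_j\neq\emptyset\ \forall j\in u\}$. For $v\subseteq\{1,\dots,ds\}$, $\partial^v$ denotes the mixed partial derivative taken once in each coordinate of $v$, with value $0$ where it does not exist. Let $\mathrm{rect}(A)$ be the bounding box of $A$, and let $\widetilde{\mathbb{B}}_{u\kappa\tau}$ be the bounding box of $\prod_{j\in u}X_{j,(k_j,t_j)}\times\prod_{j\notin u}X^{(j)}$. Assume one of the following. 1. $X^{1:s}$ is Sobol'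 extensible with anchor $c$, that is, $X^{1:s}$ is closed with non-empty interior, $c\in X^{1:s}$, and $\mathrm{rect}\{c,z\}\subseteq X^{1:s}$ for all $z\in X^{1:s}$; $f$ is smooth, that is, all $\partial^v f$ exist and are continuous on $X^{1:s}$; and $\tilde f_u$ is the Sobol' extension $$\tilde f_u(x)=\sum_{w\subseteq\{1,\dots,ds\}}\int_{[c_w,x_w]}\partial^w f_u(c_{-w}{:}y_w)\,1_{c_{-w}{:}y_w\in X^{1:s}}\,dy_w,$$ where $c_{-w}{:}y_w$ has coordinates $y_\ell$ for $\ell\in w$ and $c_\ell$ for $\ell\notin w$, and $\int_{[c_w,x_w]}$ is the integral over $\mathrm{rect}\{c_w,x_w\}$, with a minus sign if $c_\ell>x_\ell$ for an odd number of $\ell\in w$. 2. Each $X^{(j)}$ is closed with non-empty interior and boundary of measure zero; $f\in C^{ds}(X^{1:s})$, that is, all partial derivatives of $f$ of total order at most $ds$ exist and are continuous on $X^{1:s}$; and $\tilde f_u\in C^{ds}(\mathrm{rect}(X^{1:s}))$ is a function that agrees with $f_u$ on $X^{1:s}$ (for example, the Whitney extension of $f_u$). **Claim.** Let $h_u(z)=\max_{v\in\mathbb{S}_u}|\partial^v\tilde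 f_u(z)|$ and let $\|h_u\|_\infty$ be its essential supremum over $\bigcup_\tau\widetilde{\mathbb{B}}_{u\kappa\tau}$. Then, for every $u\subseteq\{1,\dots,s\}$ and every $\kappa$, $$\sigma_{u\kappa}^2\le\Bigl[\widetilde C^2\Bigl(2-\frac2b\Bigr)^3\Bigr]^{|u|}\,b^{-2|\kappa|/d}\,\|h_u\|_\infty^2,\qquad \widetilde C=d^{1/2}(2^d-1)C^d .$$ -/

import Mathlib

open MeasureTheory Set
open scoped ENNReal NNReal

namespace ScrambledGeometric

noncomputable section

/-- The concatenated space `ℝ^{ds}`: coordinate `(j, i)` is the `i`-th component of the `j`-th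
block `x_j ∈ ℝ^d`. -/
abbrev Pt (s d : ℕ) : Type := Fin s × Fin d → ℝ

/-- The block `x_j ∈ ℝ^d` (with the Euclidean norm) of `x ∈ ℝ^{ds}`. -/
def block {s d : ℕ} (x : Pt s d) (j : Fin s) : EuclideanSpace ℝ (Fin d) :=
  WithLp.toLp 2 (fun i => x (j, i))

/-- The Cartesian product `X^{1:s}` as a subset of `ℝ^{ds}`. -/
def prodSet {s d : ℕ} (X : Fin s → Set (EuclideanSpace ℝ (Fin d))) : Set (Pt s d) :=
  {x | ∀ j, block x j ∈ X j}

/-- A recursive `b`-fold split of `X`. The cells of level `k` are `X_{a_1,…,a_k}`, indexed by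
digit words of length `k`, equivalently by `t ∈ {0, …, b^k - 1}`. -/
structure RecursiveSplit {d : ℕ} (b : ℕ) (X : Set (EuclideanSpace ℝ (Fin d))) where
  cell : (k : ℕ) → (Fin k → Fin b) → Set (EuclideanSpace ℝ (Fin d))
  cell_zero : ∀ w, cell 0 w = X
  measurableSet_cell : ∀ k w, MeasurableSet (cell k w)
  cell_eq_iUnion : ∀ k w, cell k w = ⋃ c : Fin b, cell (k + 1) (Fin.snoc w c)
  volume_child : ∀ k w (c : Fin b), volume (cell (k + 1) (Fin.snoc w c)) = volume (cell k w) / b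
  volume_inter : ∀ k w (c c' : Fin b), c ≠ c' →
    volume (cell (k + 1) (Fin.snoc w c) ∩ cell (k + 1) (Fin.snoc w c')) = 0

/-! ### Partial derivatives and smoothness -/

/-- The hybrid point `x_{-w} : y_w`. -/
def hybrid {ι : Type*} [DecidableEq ι] (w : Finset ι) (x : ι → ℝ) (y : w → ℝ) : ι → ℝ :=
  fun p => if h : p ∈ w then y ⟨p, h⟩ else x p

/-- The partial derivative in the coordinate `p`; it is `0` where it does not exist. -/
def pderiv {ι : Type*} [DecidableEq ι] (p : ι) (g : (ι → ℝ) → ℝ) : (ι → ℝ) → ℝ :=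
  fun x => deriv (fun t => g (Function.update x p t)) (x p)

/-- The mixed partial derivative `∂^v g`, once in each coordinate of `v`. -/
def mixedPartial {s d : ℕ} (v : Finset (Fin s × Fin d)) (g : Pt s d → ℝ) : Pt s d → ℝ :=
  (((List.finRange s).product (List.finRange d)).filter (fun p => p ∈ v)).foldr pderiv g

/-- At the point `x`, the number `g'` is the partial derivative in coordinate `p` of the function
`g` on the set `A` (one-sided at an end of a segment of the coordinate line in `A`). -/
def HasPartialWithin {ι : Type*} [DecidableEq ι] (A : Set (ι → ℝ)) (p : ι)
    (g : (ι → ℝ) → ℝ) (g' : ℝ) (x : ι → ℝ) : Prop :=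
  HasDerivWithinAt (fun t => g (Function.update x p t)) g' {t | Function.update x p t ∈ A} (x p)

/-- `f` is smooth on `A`: its mixed partial derivatives `∂^v f`, at most one derivative in each
coordinate, exist and are continuous on `A`. -/
def SmoothOn {ι : Type*} [DecidableEq ι] (A : Set (ι → ℝ)) (f : (ι → ℝ) → ℝ) : Prop :=
  ∃ D : Finset ι → (ι → ℝ) → ℝ,
    EqOn (D ∅) f A ∧ (∀ v, ContinuousOn (D v) A) ∧
    ∀ v, ∀ p ∉ v, ∀ x ∈ A, HasPartialWithin A p (D v) (D (insert p v) x) x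

/-- `f ∈ C^m(A)`: all partial derivatives of total order at most `m` exist and are continuous
on `A`. -/
def CmOn {ι : Type*} [DecidableEq ι] [Fintype ι] (m : ℕ) (A : Set (ι → ℝ))
    (f : (ι → ℝ) → ℝ) : Prop :=
  ∃ D : (ι → ℕ) → (ι → ℝ) → ℝ,
    EqOn (D 0) f A ∧ (∀ k, ∑ p, k p ≤ m → ContinuousOn (D k) A) ∧
    ∀ k, ∑ p, k p < m → ∀ p, ∀ x ∈ A, HasPartialWithin A p (D k) (D (k + Pi.single p 1) x) x

/-! ### Rectangular hulls and extensions -/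

/-- The rectangular hull (bounding box) of a nonempty bounded set. -/
def rectHull {ι : Type*} (A : Set (ι → ℝ)) : Set (ι → ℝ) :=
  Icc (fun p => sInf ((fun x => x p) '' A)) (fun p => sSup ((fun x => x p) '' A))

/-- `A` is Sobol' extensible with anchor `c`. -/
def IsSobolExtensible {ι : Type*} (A : Set (ι → ℝ)) (c : ι → ℝ) : Prop :=
  IsClosed A ∧ (interior A).Nonempty ∧ c ∈ A ∧
    ∀ z ∈ A, {y : ι → ℝ | ∀ p, y p ∈ uIcc (c p) (z p)} ⊆ A

open Classical in
/-- The Sobol' extension of `g` from `A` with anchor `c`: the sum over `w` of the signed integrals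
over `[c_w, x_w]` of `∂^w g (c_{-w} : y_w)` times the indicator of `c_{-w} : y_w ∈ A`. -/
def sobolExtension {s d : ℕ} (A : Set (Pt s d)) (c : Pt s d) (g : Pt s d → ℝ) : Pt s d → ℝ :=
  fun x => ∑ w : Finset (Fin s × Fin d),
    (-1 : ℝ) ^ (w.filter (fun p => x p < c p)).card *
      ∫ y in (univ.pi fun p : w => uIcc (c p) (x p) : Set (w → ℝ)),
        A.indicator (mixedPartial w g) (hybrid w c y)

/-- `F` is a `C^m` function on the bounding box of `A` that agrees with `g` on `A`. The Whitney
extension of `g` is such a function; its further properties are not required. -/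
def IsCmExtension {ι : Type*} [Fintype ι] (m : ℕ) (A : Set (ι → ℝ))
    (g F : (ι → ℝ) → ℝ) : Prop :=
  ContDiffOn ℝ (m : WithTop ℕ∞) F (rectHull A) ∧ EqOn F g A

/-! ### ANOVA -/

/-- The coordinates of the blocks `j ∈ u`. -/
def coords {s : ℕ} (d : ℕ) (u : Finset (Fin s)) : Finset (Fin s × Fin d) :=
  Finset.univ.filter (fun p => p.1 ∈ u)

/-- The ANOVA component `f_u`, with
`f_u(x) = ∫_{X^{-u}} (f(x) - ∑_{v ⊊ u} f_v(x)) dx_{-u}`. -/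
def anova {s d : ℕ} (X : Fin s → Set (EuclideanSpace ℝ (Fin d))) (f : Pt s d → ℝ)
    (u : Finset (Fin s)) (x : Pt s d) : ℝ :=
  ∫ y in {y : (coords d uᶜ) → ℝ | ∀ j ∉ u, block (hybrid (coords d uᶜ) x y) j ∈ X j},
    (f (hybrid (coords d uᶜ) x y) -
      ∑ v ∈ u.ssubsets.attach, anova X f v.1 (hybrid (coords d uᶜ) x y))
termination_by u.card
decreasing_by exact Finset.card_lt_card (Finset.mem_ssubsets.1 v.2)

/-! ### Multiresolution -/

section Multiresolution

variable {s d b : ℕ} {X : Fin s → Set (EuclideanSpace ℝ (Fin d))}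

/-- The univariate-block basis function
`ψ_{ktc} = b^{(k+1)/2} 1_{X_{(k,t,c)}} - b^{(k-1)/2} 1_{X_{(k,t)}}`. -/
def psiBlock {Y : Set (EuclideanSpace ℝ (Fin d))} (S : RecursiveSplit b Y) (k : ℕ)
    (t : Fin k → Fin b) (c : Fin b) (x : EuclideanSpace ℝ (Fin d)) : ℝ :=
  (b : ℝ) ^ (((k : ℝ) + 1) / 2) * (S.cell (k + 1) (Fin.snoc t c)).indicator 1 x -
    (b : ℝ) ^ (((k : ℝ) - 1) / 2) * (S.cell k t).indicator 1 x

/-- The basis function `ψ_{uκτγ}` on `X^{1:s}`. -/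
def psi (S : ∀ j, RecursiveSplit b (X j)) (u : Finset (Fin s)) (κ : u → ℕ)
    (τ : ∀ j : u, Fin (κ j) → Fin b) (γ : u → Fin b) (x : Pt s d) : ℝ :=
  ∏ j : u, psiBlock (S j) (κ j) (τ j) (γ j) (block x j)

/-- `ν_{uκ} = ∑_τ ∑_γ ⟨f, ψ_{uκτγ}⟩ ψ_{uκτγ}`. -/
def nu (S : ∀ j, RecursiveSplit b (X j)) (f : Pt s d → ℝ) (u : Finset (Fin s)) (κ : u → ℕ)
    (x : Pt s d) : ℝ :=
  ∑ τ : (∀ j : u, Fin (κ j) → Fin b), ∑ γ : u → Fin b,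
    (∫ z in prodSet X, f z * psi S u κ τ γ z) * psi S u κ τ γ x

/-- `σ²_{uκ} = ∫_{X^{1:s}} ν_{uκ}²`. -/
def sigmaSq (S : ∀ j, RecursiveSplit b (X j)) (f : Pt s d → ℝ) (u : Finset (Fin s))
    (κ : u → ℕ) : ℝ :=
  ∫ x in prodSet X, nu S f u κ x ^ 2

/-- The product `B_{uκτ}` of the cells `X_{j,(k_j,t_j)}`, `j ∈ u`, and the `X^{(j)}`, `j ∉ u`. -/
def cellBox (S : ∀ j, RecursiveSplit b (X j)) (u : Finset (Fin s)) (κ : u → ℕ)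
    (τ : ∀ j : u, Fin (κ j) → Fin b) : Set (Pt s d) :=
  {x | (∀ j : u, block x j ∈ (S j).cell (κ j) (τ j)) ∧ ∀ j ∉ u, block x j ∈ X j}

/-- The subsets of `S_u` that meet `S_j` for each `j ∈ u`. -/
def coverSets (d : ℕ) (u : Finset (Fin s)) : Finset (Finset (Fin s × Fin d)) :=
  (coords d u).powerset.filter (fun T => ∀ j ∈ u, ∃ i, (j, i) ∈ T)

/-- `h(z) = max_v |∂^v F(z)|` over the sets `v` of `coverSets d u`. -/
def hMax (u : Finset (Fin s)) (F : Pt s d → ℝ) (z : Pt s d) : ℝ :=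
  (((coverSets d u).sup fun v => ‖mixedPartial v F z‖₊ : ℝ≥0) : ℝ)

/-- The essential supremum of `hMax u F` on the union over `τ` of the bounding boxes of the sets
`B_{uκτ}`. -/
def hNorm (S : ∀ j, RecursiveSplit b (X j)) (u : Finset (Fin s)) (κ : u → ℕ)
    (F : Pt s d → ℝ) : ℝ≥0∞ :=
  eLpNorm (hMax u F) ⊤ (volume.restrict (⋃ τ, rectHull (cellBox S u κ τ)))

end Multiresolution

end

end ScrambledGeometric

/-!
Fix `u` and `κ`. Almost everywhere only one cell `τ` contributes to `ν_{uκ}`, so it suffices to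
bound the coefficients of the ANOVA component `f_u`, which has the same coefficients as `f`. On the
bounding box of `B_{uκτ}`, expand an extension of `f_u` at an anchor `a` into iterated integrals of
its mixed partial derivatives `∂^T`. A term whose `T` misses a block `j ∈ u` does not depend on
`x_j`, and `ψ_{uκτγ}` has mean zero in `x_j`; hence only the `T ∈ 𝕊_u` survive. There are
`(2^d - 1)^{|u|}` of them, and as `C ≥ 1` each iterated integral gains at least one side length
`C b^{-k_j/d}` per block and at most `C^d`.

This needs the integral form of `∂^T`, which is that of a function `C^{ds}` on the bounding box. For
the Sobol' extension it holds with the iterated integrals of `∂^w f_u 1_X` in place of the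
derivatives. These agree with the derivatives almost everywhere, because the frontier of a set
closed under taking bounding boxes with `c` is a null set: after reflections at `c`, the part of
the set in each open orthant with corner `c` is order connected.
-/

namespace ScrambledGeometric

noncomputable section

section Hybrid

variable {ι : Type*} [DecidableEq ι]

theorem hybrid_of_mem {w : Finset ι} {p : ι} (h : p ∈ w) (x : ι → ℝ) (y : w → ℝ) :
    hybrid w x y p = y ⟨p, h⟩ := dif_pos h

theorem hybrid_of_notMem {w : Finset ι} {p : ι} (h : p ∉ w) (x : ι → ℝ) (y : w → ℝ) :
    hybrid w x y p = x p := dif_neg h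

theorem hybrid_empty (x : ι → ℝ) (y : (∅ : Finset ι) → ℝ) : hybrid ∅ x y = x :=
  Function.updateFinset_empty

theorem hybrid_restrict (w : Finset ι) (x z : ι → ℝ) :
    hybrid w x (fun p => z p) = w.piecewise z x := by
  ext p; by_cases h : p ∈ w <;> simp [hybrid, h]

theorem hybrid_congr {w : Finset ι} {x x' : ι → ℝ} (h : ∀ p ∉ w, x p = x' p) (y : w → ℝ) :
    hybrid w x y = hybrid w x' y := by
  ext p; by_cases hp : p ∈ w <;> simp [hybrid, hp, h]

theorem hybrid_update_of_mem {w : Finset ι} {p : ι} (h : p ∈ w) (x : ι → ℝ) (t : ℝ) (y : w → ℝ) :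
    hybrid w (Function.update x p t) y = hybrid w x y :=
  hybrid_congr (fun _ hq => Function.update_of_ne (ne_of_mem_of_not_mem h hq).symm _ _) y

theorem hybrid_update_of_notMem {w : Finset ι} {p : ι} (h : p ∉ w) (x : ι → ℝ) (t : ℝ)
    (y : w → ℝ) : hybrid w (Function.update x p t) y = Function.update (hybrid w x y) p t := by
  ext q
  obtain rfl | hq := eq_or_ne q p
  · simp [hybrid, h]
  · by_cases hw : q ∈ w <;> simp [hybrid, hw, hq]

theorem continuous_hybrid (w : Finset ι) :
    Continuous fun q : (ι → ℝ) × (w → ℝ) => hybrid w q.1 q.2 := by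
  refine continuous_pi fun p => ?_
  by_cases h : p ∈ w
  · simp only [hybrid_of_mem h]
    exact (continuous_apply (⟨p, h⟩ : w)).comp continuous_snd
  · simp only [hybrid_of_notMem h]
    exact (continuous_apply p).comp continuous_fst

theorem continuous_hybrid_right (w : Finset ι) (x : ι → ℝ) : Continuous (hybrid w x) :=
  (continuous_hybrid w).comp (Continuous.prodMk_right x)

theorem measurable_hybrid (w : Finset ι) :
    Measurable fun q : (ι → ℝ) × (w → ℝ) => hybrid w q.1 q.2 :=
  measurable_updateFinset'

theorem measurable_hybrid_right (w : Finset ι) (x : ι → ℝ) : Measurable (hybrid w x) :=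
  measurable_updateFinset

/-- The splitting of `ℝ^ι` into the coordinates in `w` and the others; it carries the Fubini
arguments in which only the coordinates of `w` are integrated. -/
def splitEquiv (w : Finset ι) : (ι → ℝ) ≃ᵐ (w → ℝ) × ({p // p ∉ w} → ℝ) :=
  MeasurableEquiv.piEquivPiSubtypeProd (fun _ => ℝ) (· ∈ w)

theorem splitEquiv_symm_eq_hybrid (w : Finset ι) (y : w → ℝ) (x : ι → ℝ) :
    (splitEquiv w).symm (y, (splitEquiv w x).2) = hybrid w x y := rfl

variable [Fintype ι]

theorem measurePreserving_splitEquiv (w : Finset ι) :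
    MeasurePreserving (splitEquiv w) volume volume := by
  convert volume_preserving_piEquivPiSubtypeProd (fun _ : ι => ℝ) (· ∈ w) <;> rfl

theorem ae_ae_hybrid {P : (ι → ℝ) → Prop} (h : ∀ᵐ x, P x) (w : Finset ι) :
    ∀ᵐ x : ι → ℝ, ∀ᵐ y : w → ℝ, P (hybrid w x y) := by
  have h_prod : ∀ᵐ q : (w → ℝ) × ({p // p ∉ w} → ℝ), P ((splitEquiv w).symm q) :=
    (measurePreserving_splitEquiv w).symm.quasiMeasurePreserving.ae h
  have h_swap : ∀ᵐ q : ({p // p ∉ w} → ℝ) × (w → ℝ), P ((splitEquiv w).symm q.swap) :=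
    (Measure.measurePreserving_swap (μ := volume) (ν := volume)).quasiMeasurePreserving.ae h_prod
  have h_rest : Measure.QuasiMeasurePreserving (fun x : ι → ℝ => (splitEquiv w x).2)
      volume volume :=
    Measure.quasiMeasurePreserving_snd.comp (measurePreserving_splitEquiv w).quasiMeasurePreserving
  exact h_rest.ae (Measure.ae_ae_of_ae_prod h_swap)

theorem integral_eq_zero_of_forall_integral_hybrid {g : (ι → ℝ) → ℝ} (w : Finset ι)
    (h : ∀ x, ∫ y, g (hybrid w x y) = 0) : ∫ x, g x = 0 := by
  by_cases hg : Integrable g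
  · have hmp := (measurePreserving_splitEquiv w).symm
    have hint : Integrable (fun q => g ((splitEquiv w).symm q)) (volume.prod volume) :=
      (hmp.integrable_comp_emb (splitEquiv w).symm.measurableEmbedding).2 hg
    rw [← hmp.integral_comp', Measure.volume_eq_prod, integral_prod_symm _ hint]
    refine integral_eq_zero_of_ae (Filter.Eventually.of_forall fun z => ?_)
    simpa only [← splitEquiv_symm_eq_hybrid, MeasurableEquiv.apply_symm_apply, Pi.zero_apply]
      using h ((splitEquiv w).symm (0, z))
  · exact integral_undef hg

end Hybrid

section InsertCoord

variable {ι : Type*} [DecidableEq ι] {p : ι} {w : Finset ι}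

/-- Insertion of a coordinate into a vector indexed by a finite set, for Fubini arguments that
split off one coordinate. -/
def insertCoord (hp : p ∉ w) : ℝ × (w → ℝ) ≃ᵐ (↥(insert p w) → ℝ) :=
  ((MeasurableEquiv.funUnique ({p} : Finset ι) ℝ).symm.prodCongr (MeasurableEquiv.refl _)).trans
    (MeasurableEquiv.piFinsetUnion (fun _ => ℝ) (Finset.disjoint_singleton_left.2 hp))

theorem measurePreserving_insertCoord (hp : p ∉ w) :
    MeasurePreserving (insertCoord hp) volume volume :=
  ((volume_preserving_funUnique ({p} : Finset ι) ℝ).symm.prod (MeasurePreserving.id _)).trans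
    (volume_preserving_piFinsetUnion (fun _ => ℝ) (Finset.disjoint_singleton_left.2 hp))

theorem insertCoord_apply_self (hp : p ∉ w) (q : ℝ × (w → ℝ)) :
    insertCoord hp q ⟨p, Finset.mem_insert_self p w⟩ = q.1 :=
  Equiv.piFinsetUnion_left (fun _ => ℝ) (f := fun _ => q.1) (g := q.2)
    (Finset.disjoint_singleton_left.2 hp) (Finset.mem_singleton_self p) _

theorem insertCoord_apply_of_mem (hp : p ∉ w) (q : ℝ × (w → ℝ)) (r : w) :
    insertCoord hp q ⟨r, Finset.mem_insert_of_mem r.2⟩ = q.2 r :=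
  Equiv.piFinsetUnion_right (fun _ => ℝ) (f := fun _ => q.1) (g := q.2)
    (Finset.disjoint_singleton_left.2 hp) r.2 _

theorem hybrid_insertCoord (hp : p ∉ w) (z : ι → ℝ) (q : ℝ × (w → ℝ)) :
    hybrid (insert p w) z (insertCoord hp q) = hybrid w (Function.update z p q.1) q.2 := by
  ext r
  obtain rfl | hr := eq_or_ne r p
  · rw [hybrid_of_mem (Finset.mem_insert_self r w), insertCoord_apply_self, hybrid_of_notMem hp,
      Function.update_self]
  by_cases hw : r ∈ w
  · rw [hybrid_of_mem (Finset.mem_insert_of_mem hw), hybrid_of_mem hw]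
    exact insertCoord_apply_of_mem hp q ⟨r, hw⟩
  · rw [hybrid_of_notMem (by simp [hr, hw]), hybrid_of_notMem hw, Function.update_of_ne hr]

theorem insertCoord_preimage_pi (hp : p ∉ w) (s : ↥(insert p w) → Set ℝ) :
    insertCoord hp ⁻¹' univ.pi s =
      s ⟨p, Finset.mem_insert_self p w⟩ ×ˢ
        univ.pi fun r : w => s ⟨r, Finset.mem_insert_of_mem r.2⟩ := by
  ext q
  simp only [mem_preimage, mem_univ_pi, mem_prod]
  constructor
  · intro h
    exact ⟨insertCoord_apply_self hp q ▸ h _, fun r => insertCoord_apply_of_mem hp q r ▸ h _⟩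
  · rintro ⟨hq, hqw⟩ ⟨r, hr⟩
    obtain rfl | hrw := Finset.mem_insert.1 hr
    · rwa [insertCoord_apply_self]
    · exact (insertCoord_apply_of_mem hp q ⟨r, hrw⟩).symm ▸ hqw ⟨r, hrw⟩

theorem setIntegral_hybrid_insert (hp : p ∉ w) (s : ι → Set ℝ) (z : ι → ℝ) {G : (ι → ℝ) → ℝ}
    (hG : IntegrableOn (fun q : ℝ × (w → ℝ) => G (hybrid w (Function.update z p q.1) q.2))
      (s p ×ˢ univ.pi fun r : w => s r) (volume.prod volume)) :
    ∫ y in univ.pi fun r : ↥(insert p w) => s r, G (hybrid (insert p w) z y) =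
      ∫ t in s p, ∫ y in univ.pi fun r : w => s r, G (hybrid w (Function.update z p t) y) := by
  rw [← (measurePreserving_insertCoord hp).setIntegral_preimage_emb
    (insertCoord hp).measurableEmbedding, insertCoord_preimage_pi hp, Measure.volume_eq_prod]
  simp only [hybrid_insertCoord]
  exact setIntegral_prod _ hG

end InsertCoord

section SignedIntegral

variable {ι α : Type*} [MeasurableSpace α]

theorem measurableSet_spanBox (w : Finset ι) (a x : ι → ℝ) :
    MeasurableSet (univ.pi fun p : w => uIcc (a p) (x p) : Set (w → ℝ)) :=
  MeasurableSet.univ_pi fun _ => measurableSet_uIcc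

theorem volume_spanBox (w : Finset ι) (a x : ι → ℝ) :
    volume (univ.pi fun p : w => uIcc (a p) (x p) : Set (w → ℝ)) =
      ENNReal.ofReal (∏ p ∈ w, |x p - a p|) := by
  rw [volume_pi_pi, ENNReal.ofReal_prod_of_nonneg (fun _ _ => abs_nonneg _),
    ← Finset.prod_coe_sort w fun p => ENNReal.ofReal |x p - a p|]
  simp only [uIcc, Real.volume_Icc, max_sub_min_eq_abs]

theorem measurableSet_mem_spanBox (w : Finset ι) (a : ι → ℝ) {x : α → ι → ℝ} (hx : Measurable x) :
    MeasurableSet {r : α × (w → ℝ) | r.2 ∈ univ.pi fun p : w => uIcc (a p) (x r.1 p)} := by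
  simp only [mem_univ_pi, uIcc, mem_Icc, ofPred_forall]
  have hxp : ∀ p : w, Measurable fun r : α × (w → ℝ) => x r.1 p := fun p =>
    (measurable_pi_apply p.1).comp (hx.comp measurable_fst)
  have hyp : ∀ p : w, Measurable fun r : α × (w → ℝ) => r.2 p := fun p =>
    (measurable_pi_apply p).comp measurable_snd
  exact MeasurableSet.iInter fun p =>
    (measurableSet_le (measurable_const.min (hxp p)) (hyp p)).inter
      (measurableSet_le (hyp p) (measurable_const.max (hxp p)))

variable [DecidableEq ι]

/-- The integral of `G` in the coordinates of `w` over the box spanned by `a` and `x`, with the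
sign of the orientation; the other coordinates are those of `z`. -/
def signedIntegral (w : Finset ι) (a x : ι → ℝ) (G : (ι → ℝ) → ℝ) (z : ι → ℝ) : ℝ :=
  (-1 : ℝ) ^ (w.filter (fun p => x p < a p)).card *
    ∫ y in (univ.pi fun p : w => uIcc (a p) (x p) : Set (w → ℝ)), G (hybrid w z y)

theorem signedIntegral_empty (a x : ι → ℝ) (G : (ι → ℝ) → ℝ) (z : ι → ℝ) :
    signedIntegral ∅ a x G z = G z := by
  simp [signedIntegral, hybrid_empty, volume_pi, Measure.real, eq_univ_of_forall]

theorem signedIntegral_congr {w : Finset ι} {a x x' z z' : ι → ℝ} {G G' : (ι → ℝ) → ℝ}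
    (hx : ∀ p ∈ w, x p = x' p)
    (hG : ∀ y ∈ (univ.pi fun p : w => uIcc (a p) (x p) : Set (w → ℝ)),
      G (hybrid w z y) = G' (hybrid w z' y)) :
    signedIntegral w a x G z = signedIntegral w a x' G' z' := by
  have h_sign : w.filter (fun p => x p < a p) = w.filter (fun p => x' p < a p) :=
    Finset.filter_congr fun p hp => by rw [hx p hp]
  have h_box : (univ.pi fun p : w => uIcc (a p) (x p) : Set (w → ℝ)) =
      univ.pi fun p : w => uIcc (a p) (x' p) :=
    pi_congr rfl fun p _ => by rw [hx p p.2]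
  rw [signedIntegral, setIntegral_congr_fun (measurableSet_spanBox w a x) hG, h_sign, h_box,
    signedIntegral]

theorem abs_signedIntegral_le {w : Finset ι} {a x z : ι → ℝ} {G : (ι → ℝ) → ℝ} {M : ℝ}
    (h : ∀ᵐ y : w → ℝ, y ∈ (univ.pi fun p : w => uIcc (a p) (x p) : Set (w → ℝ)) →
      |G (hybrid w z y)| ≤ M) :
    |signedIntegral w a x G z| ≤ M * ∏ p ∈ w, |x p - a p| := by
  have h_vol := volume_spanBox w a x
  have := norm_setIntegral_le_of_norm_le_const_ae (μ := volume) (f := fun y => G (hybrid w z y))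
    (h_vol.trans_lt ENNReal.ofReal_lt_top)
    ((ae_restrict_iff' (measurableSet_spanBox w a x)).2 h)
  rwa [Real.norm_eq_abs, Measure.real, h_vol, ENNReal.toReal_ofReal
    (Finset.prod_nonneg fun _ _ => abs_nonneg _), ← one_mul |_|,
    ← abs_neg_one_pow (w.filter fun p => x p < a p).card, ← abs_mul] at this

theorem measurable_signedIntegral (w : Finset ι) (a : ι → ℝ) {G : (ι → ℝ) → ℝ}
    (hG : Measurable G) {x z : α → ι → ℝ} (hx : Measurable x) (hz : Measurable z) :
    Measurable fun q => signedIntegral w a (x q) G (z q) := by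
  refine Measurable.mul ?_ ?_
  · simp_rw [← Finset.prod_const, Finset.prod_filter]
    exact Finset.measurable_prod _ fun p _ => Measurable.ite
      (measurableSet_lt ((measurable_pi_apply p).comp hx) measurable_const)
      measurable_const measurable_const
  · have hF : Measurable fun r : α × (w → ℝ) => G (hybrid w (z r.1) r.2) :=
      hG.comp ((measurable_hybrid w).comp ((hz.comp measurable_fst).prodMk measurable_snd))
    have h_ind : StronglyMeasurable (Function.uncurry fun (q : α) (y : w → ℝ) =>
        (univ.pi fun p : w => uIcc (a p) (x q p) : Set (w → ℝ)).indicator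
          (fun y => G (hybrid w (z q) y)) y) :=
      (hF.indicator (measurableSet_mem_spanBox w a hx)).stronglyMeasurable
    have := (h_ind.integral_prod_right (ν := volume)).measurable
    simpa only [integral_indicator (measurableSet_spanBox w a _)] using this

theorem signedIntegral_insert {p : ι} {w : Finset ι} (hp : p ∉ w) (a x z : ι → ℝ)
    {G : (ι → ℝ) → ℝ} {K : ℝ} (hG : Measurable G) (hK : ∀ x, |G x| ≤ K) :
    signedIntegral (insert p w) a x G z =
      ∫ t in (a p)..(x p), signedIntegral w a x G (Function.update z p t) := by
  have h_int : IntegrableOn (fun q : ℝ × (w → ℝ) => G (hybrid w (Function.update z p q.1) q.2))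
      (uIcc (a p) (x p) ×ˢ univ.pi fun r : w => uIcc (a r) (x r)) (volume.prod volume) := by
    refine Measure.integrableOn_of_bounded (M := K) ?_ (Measurable.aestronglyMeasurable ?_)
      (Filter.Eventually.of_forall fun y => hK _)
    · rw [Measure.prod_prod, volume_spanBox]
      exact ENNReal.mul_ne_top isCompact_uIcc.measure_lt_top.ne ENNReal.ofReal_ne_top
    · exact hG.comp ((measurable_hybrid w).comp
        (((measurable_update z).comp measurable_fst).prodMk measurable_snd))
  unfold signedIntegral
  rw [setIntegral_hybrid_insert hp (fun r => uIcc (a r) (x r)) z h_int,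
    intervalIntegral.integral_const_mul, Finset.filter_insert]
  rcases lt_or_ge (x p) (a p) with h | h
  · rw [if_pos h, Finset.card_insert_of_notMem (by simp [hp]), intervalIntegral.integral_of_ge h.le,
      ← integral_Icc_eq_integral_Ioc, uIcc_of_ge h.le, pow_succ]
    ring
  · rw [if_neg (not_lt.2 h), intervalIntegral.integral_of_le h, ← integral_Icc_eq_integral_Ioc,
      uIcc_of_le h]

theorem intervalIntegrable_signedIntegral (w : Finset ι) (a x z : ι → ℝ) (p : ι)
    {G : (ι → ℝ) → ℝ} {K : ℝ} (hG : Measurable G) (hK : ∀ x, |G x| ≤ K) (s r : ℝ) :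
    IntervalIntegrable (fun t => signedIntegral w a x G (Function.update z p t)) volume s r :=
  intervalIntegrable_iff.2 <| Measure.integrableOn_of_bounded (M := K * ∏ p ∈ w, |x p - a p|)
    (by simp [uIoc])
    (measurable_signedIntegral w a hG measurable_const
      (measurable_update z)).aestronglyMeasurable
    (Filter.Eventually.of_forall fun _ =>
      abs_signedIntegral_le (Filter.Eventually.of_forall fun _ _ => hK _))

end SignedIntegral

section IntegralFamily

variable {ι : Type*} [DecidableEq ι]

/-- Uniformly bounded measurable functions `G T` such that, along the segments of coordinate lines
in `B`, the function `G (insert p T)` is an integrated derivative of `G T` in the coordinate `p`.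
This is all that the estimate of the coefficients uses of the mixed partial derivatives. -/
structure IsIntegralFamily (B : Set (ι → ℝ)) (G : Finset ι → (ι → ℝ) → ℝ) : Prop where
  measurable : ∀ T, Measurable (G T)
  exists_bound : ∃ K, ∀ T x, |G T x| ≤ K
  sub_eq_integral : ∀ T, ∀ p ∉ T, ∀ x ∈ B, ∀ s, (∀ t ∈ uIcc s (x p), Function.update x p t ∈ B) →
    G T x - G T (Function.update x p s) =
      ∫ t in s..(x p), G (insert p T) (Function.update x p t)

theorem IsIntegralFamily.mono {B B' : Set (ι → ℝ)} {G : Finset ι → (ι → ℝ) → ℝ}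
    (h : IsIntegralFamily B G) (hB : B' ⊆ B) : IsIntegralFamily B' G where
  measurable := h.measurable
  exists_bound := h.exists_bound
  sub_eq_integral T p hp x hx s hs :=
    h.sub_eq_integral T p hp x (hB hx) s fun t ht => hB (hs t ht)

/-- The term of index `w` in the expansion of a function at the anchor `a` in the coordinates of
`W`, for `w ⊆ W`; the argument `g` is to be the derivative of that function in `w`. -/
def anchoredTerm (W w : Finset ι) (a : ι → ℝ) (g : (ι → ℝ) → ℝ) (x : ι → ℝ) : ℝ :=
  signedIntegral w a x g (W.piecewise a x)

theorem anchoredTerm_update_anchor {W w : Finset ι} {p : ι} (hpW : p ∉ W) (hw : w ⊆ W)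
    (a x : ι → ℝ) (g : (ι → ℝ) → ℝ) :
    anchoredTerm W w a g (Function.update x p (a p)) = anchoredTerm (insert p W) w a g x := by
  unfold anchoredTerm
  rw [← Finset.update_piecewise_of_notMem _ _ _ hpW, ← Finset.piecewise_insert]
  exact signedIntegral_congr (fun q hq => Function.update_of_ne
    (ne_of_mem_of_not_mem (hw hq) hpW) _ _) fun _ _ => rfl

theorem integral_anchoredTerm_update {W w : Finset ι} {p : ι} (hpW : p ∉ W) (hw : w ⊆ W)
    (a x : ι → ℝ) {g : (ι → ℝ) → ℝ} {K : ℝ} (hg : Measurable g) (hK : ∀ x, |g x| ≤ K) :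
    ∫ t in (a p)..(x p), anchoredTerm W w a g (Function.update x p t) =
      anchoredTerm (insert p W) (insert p w) a g x := by
  unfold anchoredTerm
  rw [signedIntegral_insert (fun hp => hpW (hw hp)) a x _ hg hK]
  refine intervalIntegral.integral_congr fun t _ => ?_
  refine signedIntegral_congr (fun q hq => Function.update_of_ne
    (ne_of_mem_of_not_mem (hw hq) hpW) _ _) fun y _ => ?_
  rw [← Finset.update_piecewise_of_notMem _ _ _ hpW, Finset.piecewise_insert,
    Function.update_idem]

theorem intervalIntegrable_anchoredTerm_update {W : Finset ι} {p : ι} (hpW : p ∉ W) {w : Finset ι}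
    (hw : w ⊆ W) (a x : ι → ℝ) {g : (ι → ℝ) → ℝ} {K : ℝ} (hg : Measurable g)
    (hK : ∀ x, |g x| ≤ K) (s r : ℝ) :
    IntervalIntegrable (fun t => anchoredTerm W w a g (Function.update x p t)) volume s r := by
  refine (intervalIntegrable_signedIntegral w a x (W.piecewise a x) p hg hK s r).congr
    fun t _ => ?_
  refine signedIntegral_congr (fun q hq => (Function.update_of_ne
    (ne_of_mem_of_not_mem (hw hq) hpW) _ _).symm) fun y _ => ?_
  rw [Finset.update_piecewise_of_notMem _ _ _ hpW]

theorem IsIntegralFamily.eq_sum_anchoredTerm {B : Set (ι → ℝ)} {G : Finset ι → (ι → ℝ) → ℝ}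
    (h : IsIntegralFamily B G) {a : ι → ℝ}
    (hB : ∀ x ∈ B, {y : ι → ℝ | ∀ p, y p ∈ uIcc (a p) (x p)} ⊆ B) (W : Finset ι) :
    ∀ v, Disjoint v W → ∀ x ∈ B, G v x = ∑ w ∈ W.powerset, anchoredTerm W w a (G (v ∪ w)) x := by
  obtain ⟨K, hK⟩ := h.exists_bound
  induction W using Finset.induction_on with
  | empty => intro v _ x _; simp [anchoredTerm, signedIntegral_empty]
  | insert p W hpW ih =>
    intro v hv x hx
    rw [Finset.disjoint_insert_right] at hv
    have hseg : ∀ t ∈ uIcc (a p) (x p), Function.update x p t ∈ B := by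
      refine fun t ht => hB x hx fun q => ?_
      obtain rfl | hq := eq_or_ne q p
      · simpa using ht
      · simp [hq]
    have h_anchor : G v (Function.update x p (a p)) =
        ∑ w ∈ W.powerset, anchoredTerm (insert p W) w a (G (v ∪ w)) x := by
      rw [ih v hv.2 _ (hseg _ left_mem_uIcc)]
      exact Finset.sum_congr rfl fun w hw =>
        anchoredTerm_update_anchor hpW (Finset.mem_powerset.1 hw) a x _
    have h_integral : ∫ t in (a p)..(x p), G (insert p v) (Function.update x p t) =
        ∑ w ∈ W.powerset, anchoredTerm (insert p W) (insert p w) a (G (v ∪ insert p w)) x := by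
      rw [intervalIntegral.integral_congr fun t ht =>
          ih (insert p v) (by simp [hpW, hv.2]) _ (hseg t ht),
        intervalIntegral.integral_finsetSum fun w hw => intervalIntegrable_anchoredTerm_update hpW
          (Finset.mem_powerset.1 hw) a x (h.measurable _) (hK _) _ _]
      refine Finset.sum_congr rfl fun w hw => ?_
      rw [integral_anchoredTerm_update hpW (Finset.mem_powerset.1 hw) a x (h.measurable _) (hK _),
        Finset.union_insert, Finset.insert_union]
    rw [Finset.sum_powerset_insert hpW, ← h_anchor, ← h_integral,
      ← h.sub_eq_integral v p hv.1 x hx (a p) hseg, add_sub_cancel]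

theorem integral_eq_sub_of_hasPartialWithin {B : Set (ι → ℝ)} {g g' : (ι → ℝ) → ℝ} {p : ι}
    (hg : ContinuousOn g B) (hg' : ContinuousOn g' B)
    (hd : ∀ x ∈ B, HasPartialWithin B p g (g' x) x) {x : ι → ℝ} {s : ℝ}
    (hs : ∀ t ∈ uIcc s (x p), Function.update x p t ∈ B) :
    ∫ t in s..(x p), g' (Function.update x p t) = g x - g (Function.update x p s) := by
  have h_line : ∀ {k : (ι → ℝ) → ℝ}, ContinuousOn k B →
      ContinuousOn (fun t => k (Function.update x p t)) (uIcc s (x p)) := fun hk =>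
    hk.comp (continuous_const.update (f := fun _ => x) p continuous_id).continuousOn hs
  have := intervalIntegral.integral_eq_sub_of_hasDeriv_right (a := s) (b := x p)
    (f := fun t => g (Function.update x p t)) (f' := fun t => g' (Function.update x p t))
    (h_line hg) ?_ (h_line hg').intervalIntegrable
  · simpa only [Function.update_eq_self] using this
  · intro t ht
    have h_within := hd _ (hs t (Ioo_subset_Icc_self ht))
    simp only [HasPartialWithin, Function.update_idem, Function.update_self] at h_within
    exact (h_within.hasDerivAt (Filter.mem_of_superset (Ioo_mem_nhds ht.1 ht.2)
      fun r hr => hs r (Ioo_subset_Icc_self hr))).hasDerivWithinAt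

end IntegralFamily

section AnchoredBound

variable {ι : Type*}

theorem mem_Icc_of_forall_mem_uIcc {l m a x y : ι → ℝ} (ha : a ∈ Icc l m) (hx : x ∈ Icc l m)
    (hy : ∀ p, y p ∈ uIcc (a p) (x p)) : y ∈ Icc l m :=
  have h_mem p := uIcc_subset_Icc ⟨ha.1 p, ha.2 p⟩ ⟨hx.1 p, hx.2 p⟩ (hy p)
  ⟨fun p => (h_mem p).1, fun p => (h_mem p).2⟩

variable [DecidableEq ι] {W w : Finset ι} {a : ι → ℝ} {g : (ι → ℝ) → ℝ}

theorem dependsOn_anchoredTerm (W w : Finset ι) (a : ι → ℝ) (g : (ι → ℝ) → ℝ) :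
    DependsOn (anchoredTerm W w a g) (↑w ∪ (↑W)ᶜ) := by
  refine fun x x' h => signedIntegral_congr (fun p hp => h p (Or.inl hp)) fun y _ => ?_
  have : W.piecewise a x = W.piecewise a x' := by
    ext p
    by_cases hp : p ∈ W
    · simp [hp]
    · simpa [hp] using h p (Or.inr hp)
  rw [this]

theorem measurable_anchoredTerm (W w : Finset ι) (a : ι → ℝ) (hg : Measurable g) :
    Measurable (anchoredTerm W w a g) := by
  refine measurable_signedIntegral w a hg measurable_id (measurable_pi_lambda _ fun p => ?_)
  by_cases hp : p ∈ W
  · simpa only [hp, Finset.piecewise_eq_of_mem] using measurable_const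
  · simpa only [hp, not_false_eq_true, Finset.piecewise_eq_of_notMem] using measurable_pi_apply p

theorem abs_anchoredTerm_le {l m x : ι → ℝ} (ha : a ∈ Icc l m) (hx : x ∈ Icc l m) {M : ℝ}
    (hM0 : 0 ≤ M) (hM : ∀ᵐ y : w → ℝ, hybrid w (W.piecewise a x) y ∈ Icc l m →
      |g (hybrid w (W.piecewise a x) y)| ≤ M) :
    |anchoredTerm W w a g x| ≤ M * ∏ p ∈ w, (m p - l p) := by
  refine (abs_signedIntegral_le (M := M) ?_).trans (mul_le_mul_of_nonneg_left
    (Finset.prod_le_prod (fun _ _ => abs_nonneg _) fun p _ => ?_) hM0)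
  · filter_upwards [hM] with y hy hy_box
    refine hy (mem_Icc_of_forall_mem_uIcc ha hx fun p => ?_)
    by_cases hp : p ∈ w
    · rw [hybrid_of_mem hp]
      exact hy_box ⟨p, hp⟩ (mem_univ _)
    · rw [hybrid_of_notMem hp]
      by_cases hpW : p ∈ W <;> simp [hpW]
  · exact abs_sub_le_of_le_of_le (hx.1 p) (hx.2 p) (ha.1 p) (ha.2 p)

variable [Fintype ι]

theorem exists_generic_anchor {R : Set (ι → ℝ)} (hR : volume R ≠ 0) (W : Finset ι)
    {P : (ι → ℝ) → Prop} (hP : ∀ᵐ x, P x) :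
    ∃ a ∈ R, ∀ᵐ x : ι → ℝ, ∀ w : Finset ι, ∀ᵐ y : w → ℝ, P (hybrid w (W.piecewise a x) y) := by
  have h_slices : ∀ᵐ x : ι → ℝ, ∀ w : Finset ι, ∀ᵐ y : w → ℝ, P (hybrid w x y) :=
    ae_all_iff.2 fun w => ae_ae_hybrid hP w
  obtain ⟨a, haR, ha⟩ :=
    ((frequently_ae_mem_iff.2 hR).and_eventually (ae_ae_hybrid h_slices Wᶜ)).exists
  have h_restrict : Measure.QuasiMeasurePreserving (fun x : ι → ℝ => (splitEquiv Wᶜ x).1)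
      volume volume :=
    Measure.quasiMeasurePreserving_fst.comp (measurePreserving_splitEquiv Wᶜ).quasiMeasurePreserving
  refine ⟨a, haR, ?_⟩
  filter_upwards [h_restrict.ae ha] with x hx
  rwa [show hybrid Wᶜ a (splitEquiv Wᶜ x).1 = W.piecewise a x by
    rw [← Finset.piecewise_compl, ← hybrid_restrict]; rfl] at hx

theorem integrable_anchoredTerm_mul {l m : ι → ℝ} (ha : a ∈ Icc l m) {Φ : (ι → ℝ) → ℝ}
    (hΦ : Integrable Φ) (hΦ_supp : ∀ x ∉ Icc l m, Φ x = 0) (hg : Measurable g) {K : ℝ}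
    (hK : ∀ x, |g x| ≤ K) : Integrable fun x => anchoredTerm W w a g x * Φ x := by
  refine (hΦ.norm.const_mul (K * ∏ p ∈ w, (m p - l p))).mono'
    ((measurable_anchoredTerm W w a hg).aestronglyMeasurable.mul hΦ.1)
    (Filter.Eventually.of_forall fun x => ?_)
  by_cases hx : x ∈ Icc l m
  · rw [norm_mul]
    exact mul_le_mul_of_nonneg_right (abs_anchoredTerm_le ha hx ((abs_nonneg _).trans (hK a))
      (Filter.Eventually.of_forall fun _ _ => hK _)) (norm_nonneg _)
  · simp [hΦ_supp x hx]

theorem abs_integral_anchoredTerm_mul_le {l m : ι → ℝ} (ha : a ∈ Icc l m) {Φ : (ι → ℝ) → ℝ}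
    (hΦ : Integrable Φ) (hΦ_supp : ∀ x ∉ Icc l m, Φ x = 0) {M : ℝ} (hM0 : 0 ≤ M)
    (hM : ∀ᵐ x : ι → ℝ, ∀ᵐ y : w → ℝ, hybrid w (W.piecewise a x) y ∈ Icc l m →
      |g (hybrid w (W.piecewise a x) y)| ≤ M) :
    |∫ x, anchoredTerm W w a g x * Φ x| ≤ M * (∏ p ∈ w, (m p - l p)) * ∫ x, |Φ x| := by
  rw [← integral_const_mul]
  refine norm_integral_le_of_norm_le (f := fun x => anchoredTerm W w a g x * Φ x)
    (hΦ.norm.const_mul _) ?_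
  filter_upwards [hM] with x hx
  by_cases hx_box : x ∈ Icc l m
  · rw [norm_mul]
    exact mul_le_mul_of_nonneg_right (abs_anchoredTerm_le ha hx_box hM0 hx) (norm_nonneg _)
  · simp [hΦ_supp x hx_box]

/-- The bound on `G T` is known only almost everywhere, so the anchor of the expansion has to be
generic. -/
theorem IsIntegralFamily.abs_integral_mul_le {l m : ι → ℝ} {G : Finset ι → (ι → ℝ) → ℝ}
    (hG : IsIntegralFamily (Icc l m) G) (h_vol : volume (Icc l m) ≠ 0) {Φ : (ι → ℝ) → ℝ}
    (hΦ : Integrable Φ) (hΦ_supp : ∀ x ∉ Icc l m, Φ x = 0) {𝒯 : Finset (Finset ι)}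
    (h𝒯 : 𝒯 ⊆ W.powerset)
    (h_orth : ∀ w ⊆ W, w ∉ 𝒯 → ∀ H : (ι → ℝ) → ℝ, DependsOn H (↑w ∪ (↑W)ᶜ) →
      ∫ x, H x * Φ x = 0)
    {M : ℝ} (hM0 : 0 ≤ M) (hM : ∀ᵐ x, ∀ T ∈ 𝒯, x ∈ Icc l m → |G T x| ≤ M) :
    |∫ x, G ∅ x * Φ x| ≤ M * (∑ T ∈ 𝒯, ∏ p ∈ T, (m p - l p)) * ∫ x, |Φ x| := by
  obtain ⟨K, hK⟩ := hG.exists_bound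
  obtain ⟨a, ha, ha_generic⟩ := exists_generic_anchor h_vol W hM
  have h_expand : ∀ x, G ∅ x * Φ x = ∑ w ∈ W.powerset, anchoredTerm W w a (G w) x * Φ x := by
    intro x
    by_cases hx : x ∈ Icc l m
    · rw [hG.eq_sum_anchoredTerm (fun z hz y hy => mem_Icc_of_forall_mem_uIcc ha hz hy) W ∅
        (Finset.disjoint_empty_left _) x hx, Finset.sum_mul]
      simp only [Finset.empty_union]
    · simp [hΦ_supp x hx]
  simp_rw [h_expand]
  rw [integral_finsetSum _ fun w _ =>
      integrable_anchoredTerm_mul ha hΦ hΦ_supp (hG.measurable w) (hK w),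
    ← Finset.sum_subset h𝒯 fun w hw hw𝒯 => h_orth w (Finset.mem_powerset.1 hw) hw𝒯 _
      (dependsOn_anchoredTerm W w a (G w)), Finset.mul_sum, Finset.sum_mul]
  refine (Finset.abs_sum_le_sum_abs _ _).trans (Finset.sum_le_sum fun w hw => ?_)
  refine abs_integral_anchoredTerm_mul_le ha hΦ hΦ_supp hM0 ?_
  filter_upwards [ha_generic] with x hx
  filter_upwards [hx w] with y hy using hy w hw

end AnchoredBound

section MixedPartials

variable {ι : Type*} [DecidableEq ι]

/-- `D v`, for `v : Finset ι`, are continuous mixed partial derivatives of `f` on `A`, once in each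
coordinate of `v`: a witness of `SmoothOn A f`. -/
structure HasMixedPartialsOn (A : Set (ι → ℝ)) (f : (ι → ℝ) → ℝ)
    (D : Finset ι → (ι → ℝ) → ℝ) : Prop where
  eqOn : EqOn (D ∅) f A
  continuousOn : ∀ v, ContinuousOn (D v) A
  hasPartialWithin : ∀ v, ∀ p ∉ v, ∀ x ∈ A, HasPartialWithin A p (D v) (D (insert p v) x) x

variable {A : Set (ι → ℝ)} {f : (ι → ℝ) → ℝ} {D : Finset ι → (ι → ℝ) → ℝ}

theorem smoothOn_iff_exists_hasMixedPartialsOn :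
    SmoothOn A f ↔ ∃ D, HasMixedPartialsOn A f D :=
  exists_congr fun _ => ⟨fun h => ⟨h.1, h.2.1, h.2.2⟩, fun h => ⟨h.1, h.2, h.3⟩⟩

theorem HasMixedPartialsOn.indicator (h : HasMixedPartialsOn A f D) :
    HasMixedPartialsOn A f fun v => A.indicator (D v) := by
  have h_eq v : EqOn (A.indicator (D v)) (D v) A := eqOn_indicator
  refine ⟨(h_eq ∅).trans h.eqOn, fun v => (h.continuousOn v).congr (h_eq v),
    fun v p hp x hx => ?_⟩
  rw [h_eq _ hx]
  exact (h.hasPartialWithin v p hp x hx).congr (fun t ht => h_eq v ht)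
    (h_eq v (by rwa [Function.update_eq_self]))

theorem HasMixedPartialsOn.isIntegralFamily_indicator [Finite ι] (h : HasMixedPartialsOn A f D)
    (hA : IsCompact A) : IsIntegralFamily A fun v => A.indicator (D v) where
  measurable v := by
    classical
    rw [← piecewise_eq_indicator]
    exact (h.continuousOn v).measurable_piecewise continuousOn_const hA.measurableSet
  exists_bound := by
    cases nonempty_fintype ι
    choose K hK using fun v => hA.exists_bound_of_continuousOn (h.continuousOn v)
    refine ⟨∑ v, |K v|, fun v x => ?_⟩
    have hKv : |K v| ≤ ∑ v, |K v| :=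
      Finset.single_le_sum (fun v _ => abs_nonneg (K v)) (Finset.mem_univ v)
    by_cases hx : x ∈ A
    · rw [indicator_of_mem hx]
      exact (hK v x hx).trans ((le_abs_self _).trans hKv)
    · rw [indicator_of_notMem hx, abs_zero]
      exact (abs_nonneg _).trans hKv
  sub_eq_integral v p hp _ _ _ hs :=
    (integral_eq_sub_of_hasPartialWithin (h.indicator.continuousOn v) (h.indicator.continuousOn _)
      (h.indicator.hasPartialWithin v p hp) hs).symm

/-- `P v` is the set of points at which the derivatives in the coordinates of `v` can be computed;
such a point has to stay in `P v` when a further coordinate varies. -/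
theorem foldr_pderiv_eqOn {P : Finset ι → Set (ι → ℝ)} (h_empty : EqOn f (D ∅) (P ∅))
    (h_nhds : ∀ v, ∀ p ∉ v, ∀ x ∈ P (insert p v),
      ∀ᶠ t in nhds (x p), Function.update x p t ∈ P v)
    (h_deriv : ∀ v, ∀ p ∉ v, ∀ x ∈ P (insert p v),
      HasDerivAt (fun t => D v (Function.update x p t)) (D (insert p v) x) (x p)) :
    ∀ l : List ι, l.Nodup → EqOn (l.foldr pderiv f) (D l.toFinset) (P l.toFinset)
  | [], _ => h_empty
  | p :: l, hl => fun x hx => by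
    obtain ⟨hpl, hl⟩ := List.nodup_cons.1 hl
    have hp : p ∉ l.toFinset := mt List.mem_toFinset.1 hpl
    rw [List.toFinset_cons] at hx ⊢
    have h_eq : (fun t => l.foldr pderiv f (Function.update x p t)) =ᶠ[nhds (x p)]
        fun t => D l.toFinset (Function.update x p t) := by
      filter_upwards [h_nhds _ p hp x hx] with t ht
      exact foldr_pderiv_eqOn h_empty h_nhds h_deriv l hl ht
    exact h_eq.deriv_eq.trans (h_deriv _ p hp x hx).deriv

theorem mixedPartial_eqOn {s d : ℕ} {f : Pt s d → ℝ} {D : Finset (Fin s × Fin d) → Pt s d → ℝ}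
    {P : Finset (Fin s × Fin d) → Set (Pt s d)} (h_empty : EqOn f (D ∅) (P ∅))
    (h_nhds : ∀ v, ∀ p ∉ v, ∀ x ∈ P (insert p v),
      ∀ᶠ t in nhds (x p), Function.update x p t ∈ P v)
    (h_deriv : ∀ v, ∀ p ∉ v, ∀ x ∈ P (insert p v),
      HasDerivAt (fun t => D v (Function.update x p t)) (D (insert p v) x) (x p))
    (w : Finset (Fin s × Fin d)) : EqOn (mixedPartial w f) (D w) (P w) := by
  have h := foldr_pderiv_eqOn h_empty h_nhds h_deriv
    (((List.finRange s).product (List.finRange d)).filter (· ∈ w))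
    (((List.nodup_finRange s).product (List.nodup_finRange d)).filter _)
  have hw : (((List.finRange s).product (List.finRange d)).filter (· ∈ w)).toFinset = w := by
    ext ⟨j, i⟩
    simp [List.pair_mem_product]
  rwa [hw] at h

theorem HasMixedPartialsOn.mixedPartial_eqOn {s d : ℕ} {A O : Set (Pt s d)} {f : Pt s d → ℝ}
    {D : Finset (Fin s × Fin d) → Pt s d → ℝ} (h : HasMixedPartialsOn A f D) (hOA : O ⊆ A)
    {w : Finset (Fin s × Fin d)}
    (hO : ∀ x ∈ O, ∀ p ∈ w, ∀ᶠ t in nhds (x p), Function.update x p t ∈ O) :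
    EqOn (mixedPartial w f) (D w) O := by
  have h_deriv := ScrambledGeometric.mixedPartial_eqOn (f := f) (D := D)
    (P := fun v => {x ∈ O | v ⊆ w}) (fun x hx => (h.eqOn (hOA hx.1)).symm)
    (fun v p _ x hx => (hO x hx.1 p (hx.2 (Finset.mem_insert_self p v))).mono fun t ht =>
      ⟨ht, (Finset.subset_insert p v).trans hx.2⟩)
    (fun v p hp x hx => (h.hasPartialWithin v p hp x (hOA hx.1)).hasDerivAt
      ((hO x hx.1 p (hx.2 (Finset.mem_insert_self p v))).mono fun t ht => hOA ht)) w
  exact fun x hx => h_deriv ⟨hx, subset_rfl⟩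

theorem eventually_update_mem {U : Set (ι → ℝ)} (hU : IsOpen U) {x : ι → ℝ} (hx : x ∈ U) (p : ι) :
    ∀ᶠ t in nhds (x p), Function.update x p t ∈ U :=
  (continuous_const.update p continuous_id).continuousAt.eventually_mem
    (hU.mem_nhds (by rwa [id, Function.update_eq_self]))

end MixedPartials

section Blocks

variable {K J I : Type*} [Fintype K] [Fintype J] [Fintype I] {d : ℕ}

theorem volume_preserving_curry_symm : MeasurePreserving (MeasurableEquiv.curry J I ℝ).symm := by
  refine ⟨(MeasurableEquiv.curry J I ℝ).symm.measurable, (Measure.pi_eq fun s hs => ?_).symm⟩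
  have h_preimage : (MeasurableEquiv.curry J I ℝ).symm ⁻¹' univ.pi s =
      univ.pi fun j => univ.pi fun i => s (j, i) := by
    ext z
    simp [Function.uncurry]
  rw [Measure.map_apply (MeasurableEquiv.measurable _) (MeasurableSet.univ_pi hs), h_preimage,
    volume_pi_pi]
  simp_rw [volume_pi_pi]
  exact (Fintype.prod_prod_type' fun j i => volume (s (j, i))).symm

/-- The grouping of the coordinates of a vector into blocks of `d` coordinates. -/
def blocksEquiv (e : K ≃ J × Fin d) : (K → ℝ) ≃ᵐ (J → EuclideanSpace ℝ (Fin d)) :=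
  (MeasurableEquiv.arrowCongr' e (MeasurableEquiv.refl ℝ)).trans <|
    (MeasurableEquiv.curry J (Fin d) ℝ).trans <|
      MeasurableEquiv.piCongrRight fun _ => MeasurableEquiv.toLp 2 (Fin d → ℝ)

theorem volume_preserving_blocksEquiv (e : K ≃ J × Fin d) : MeasurePreserving (blocksEquiv e) :=
  ((volume_preserving_pi fun _ : J => PiLp.volume_preserving_toLp (Fin d)).comp
    volume_preserving_curry_symm.symm).comp
      (volume_preserving_arrowCongr' e (MeasurableEquiv.refl ℝ) (MeasurePreserving.id _))

end Blocks

section BlockCoordinates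

variable {s d : ℕ}

theorem mem_coords {u : Finset (Fin s)} {p : Fin s × Fin d} : p ∈ coords d u ↔ p.1 ∈ u := by
  simp [coords]

theorem notMem_coords_compl {u : Finset (Fin s)} {p : Fin s × Fin d} :
    p ∉ coords d uᶜ ↔ p ∈ coords d u := by simp [mem_coords]

/-- The coordinates of the blocks `j ∈ u` are pairs of a block and a coordinate in it. -/
def coordsEquiv (u : Finset (Fin s)) : coords d u ≃ u × Fin d where
  toFun p := (⟨p.1.1, mem_coords.1 p.2⟩, p.1.2)
  invFun q := ⟨(q.1, q.2), mem_coords.2 q.1.2⟩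
  left_inv _ := rfl
  right_inv _ := rfl

theorem continuous_block (j : Fin s) : Continuous fun x : Pt s d => block x j :=
  (PiLp.continuous_toLp 2 _).comp (continuous_pi fun _ => continuous_apply _)

theorem measurable_block (j : Fin s) : Measurable fun x : Pt s d => block x j :=
  (continuous_block j).measurable

theorem block_congr {x x' : Pt s d} {j : Fin s} (h : ∀ i, x (j, i) = x' (j, i)) :
    block x j = block x' j :=
  congrArg (WithLp.toLp 2) (funext h)

theorem block_hybrid_of_mem {u : Finset (Fin s)} {j : Fin s} (hj : j ∈ u) (x : Pt s d)
    (y : coords d u → ℝ) :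
    block (hybrid (coords d u) x y) j = blocksEquiv (coordsEquiv u) y ⟨j, hj⟩ :=
  congrArg (WithLp.toLp 2) (funext fun _ => hybrid_of_mem (mem_coords.2 hj) x y)

theorem block_hybrid_of_notMem {u : Finset (Fin s)} {j : Fin s} (hj : j ∉ u) (x : Pt s d)
    (y : coords d u → ℝ) : block (hybrid (coords d u) x y) j = block x j :=
  block_congr fun _ => hybrid_of_notMem (mt mem_coords.1 hj) x y

theorem volume_preserving_block : MeasurePreserving fun (x : Pt s d) j => block x j :=
  volume_preserving_blocksEquiv (Equiv.refl _)

theorem ae_block {P : EuclideanSpace ℝ (Fin d) → Prop} (h : ∀ᵐ z, P z) (j : Fin s) :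
    ∀ᵐ x : Pt s d, P (block x j) :=
  ((Measure.quasiMeasurePreserving_eval (fun _ => volume) j).comp
    volume_preserving_block.quasiMeasurePreserving).ae h

theorem integral_prod_block (φ : Fin s → EuclideanSpace ℝ (Fin d) → ℝ) :
    ∫ x : Pt s d, ∏ j, φ j (block x j) = ∏ j, ∫ z, φ j z :=
  ((volume_preserving_blocksEquiv (Equiv.refl _)).integral_comp' fun z => ∏ j, φ j (z j)).trans
    (integral_fintype_prod_volume_eq_prod φ)

theorem integrable_prod_block {φ : Fin s → EuclideanSpace ℝ (Fin d) → ℝ}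
    (hφ : ∀ j, Integrable (φ j)) : Integrable fun x : Pt s d => ∏ j, φ j (block x j) :=
  (volume_preserving_block.integrable_comp_emb
    (blocksEquiv (Equiv.refl (Fin s × Fin d))).measurableEmbedding).2 (Integrable.fintype_prod hφ)

theorem integral_block_hybrid_singleton (j : Fin s) (φ : EuclideanSpace ℝ (Fin d) → ℝ)
    (x : Pt s d) :
    ∫ y : coords d {j} → ℝ, φ (block (hybrid (coords d {j}) x y) j) = ∫ z, φ z := by
  simp_rw [block_hybrid_of_mem (Finset.mem_singleton_self j)]
  rw [(volume_preserving_blocksEquiv (coordsEquiv {j})).integral_comp'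
    (fun z => φ (z ⟨j, Finset.mem_singleton_self j⟩))]
  have h_prod := integral_fintype_prod_volume_eq_prod fun _ : ({j} : Finset (Fin s)) => φ
  simp only [Fintype.prod_subsingleton _ (⟨j, Finset.mem_singleton_self j⟩ :
    ({j} : Finset (Fin s)))] at h_prod
  exact h_prod

theorem integral_mul_prod_block_eq_zero {φ : Fin s → EuclideanSpace ℝ (Fin d) → ℝ} {j : Fin s}
    (hφ : ∫ z, φ j z = 0) {H : Pt s d → ℝ} (hH : DependsOn H (↑(coords d {j}))ᶜ) :
    ∫ x : Pt s d, H x * ∏ i, φ i (block x i) = 0 := by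
  refine integral_eq_zero_of_forall_integral_hybrid (coords d {j}) fun x => ?_
  have h_split (y : coords d {j} → ℝ) :
      H (hybrid (coords d {j}) x y) * ∏ i, φ i (block (hybrid (coords d {j}) x y) i) =
        H x * (∏ i ∈ Finset.univ.erase j, φ i (block x i)) *
          φ j (block (hybrid (coords d {j}) x y) j) := by
    rw [hH fun p hp => hybrid_of_notMem hp x y, ← Finset.prod_erase_mul _ _ (Finset.mem_univ j),
      mul_assoc]
    congr 2
    exact Finset.prod_congr rfl fun i hi => by
      rw [block_hybrid_of_notMem (mt Finset.mem_singleton.1 (Finset.ne_of_mem_erase hi))]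
  simp_rw [h_split]
  rw [integral_const_mul, integral_block_hybrid_singleton, hφ, mul_zero]

variable {X : Fin s → Set (EuclideanSpace ℝ (Fin d))}

theorem prodSet_eq_preimage : prodSet X = (fun x j => block x j) ⁻¹' univ.pi X := by
  ext x
  simp [prodSet]

theorem measurableSet_prodSet (hX : ∀ j, MeasurableSet (X j)) : MeasurableSet (prodSet X) := by
  rw [prodSet_eq_preimage]
  exact volume_preserving_block.measurable (MeasurableSet.univ_pi hX)

theorem volume_prodSet (hX : ∀ j, MeasurableSet (X j)) :
    volume (prodSet X) = ∏ j, volume (X j) := by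
  rw [prodSet_eq_preimage,
    volume_preserving_block.measure_preimage (MeasurableSet.univ_pi hX).nullMeasurableSet,
    volume_pi_pi]

theorem volume_prodSet_eq_one (hX : ∀ j, MeasurableSet (X j)) (h_vol : ∀ j, volume (X j) = 1) :
    volume (prodSet X) = 1 := by
  simp [volume_prodSet hX, h_vol]

/-- The slice of the product set in the coordinates of the blocks `j ∈ u`. -/
def sliceSet (X : Fin s → Set (EuclideanSpace ℝ (Fin d))) (u : Finset (Fin s)) :
    Set (coords d u → ℝ) :=
  blocksEquiv (coordsEquiv u) ⁻¹' univ.pi fun j : u => X j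

theorem mem_sliceSet_iff {u : Finset (Fin s)} (x : Pt s d) {y : coords d u → ℝ} :
    y ∈ sliceSet X u ↔ ∀ j ∈ u, block (hybrid (coords d u) x y) j ∈ X j := by
  simp only [sliceSet, mem_preimage, mem_univ_pi, Subtype.forall]
  exact forall₂_congr fun j hj => by rw [block_hybrid_of_mem hj]

theorem measurableSet_sliceSet (hX : ∀ j, MeasurableSet (X j)) (u : Finset (Fin s)) :
    MeasurableSet (sliceSet X u) :=
  (blocksEquiv _).measurable (MeasurableSet.univ_pi fun j : u => hX j)

theorem volume_sliceSet_eq_one (hX : ∀ j, MeasurableSet (X j)) (h_vol : ∀ j, volume (X j) = 1)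
    (u : Finset (Fin s)) : volume (sliceSet X u) = 1 := by
  rw [sliceSet, (volume_preserving_blocksEquiv _).measure_preimage
    (MeasurableSet.univ_pi fun j : u => hX j).nullMeasurableSet]
  simp [volume_pi_pi, h_vol]

theorem hybrid_mem_prodSet_iff {u : Finset (Fin s)} {x : Pt s d} {y : coords d u → ℝ} :
    hybrid (coords d u) x y ∈ prodSet X ↔ (∀ j ∉ u, block x j ∈ X j) ∧ y ∈ sliceSet X u := by
  rw [mem_sliceSet_iff x]
  refine ⟨fun h => ⟨fun j hj => ?_, fun j _ => h j⟩, fun h j => ?_⟩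
  · simpa only [block_hybrid_of_notMem hj] using h j
  · by_cases hj : j ∈ u
    · exact h.2 j hj
    · simpa only [block_hybrid_of_notMem hj] using h.1 j hj

theorem hybrid_mem_prodSet {u : Finset (Fin s)} {x : Pt s d} (hx : x ∈ prodSet X)
    {y : coords d u → ℝ} (hy : y ∈ sliceSet X u) : hybrid (coords d u) x y ∈ prodSet X :=
  hybrid_mem_prodSet_iff.2 ⟨fun j _ => hx j, hy⟩

end BlockCoordinates

section Cells

variable {d b : ℕ} {X : Set (EuclideanSpace ℝ (Fin d))}

namespace RecursiveSplit

theorem measurableSet (S : RecursiveSplit b X) : MeasurableSet X :=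
  S.cell_zero (fun i => i.elim0) ▸ S.measurableSet_cell 0 _

variable (S : RecursiveSplit b X)

theorem child_subset {k : ℕ} (t : Fin k → Fin b) (c : Fin b) :
    S.cell (k + 1) (Fin.snoc t c) ⊆ S.cell k t :=
  S.cell_eq_iUnion k t ▸ subset_iUnion (fun c => S.cell (k + 1) (Fin.snoc t c)) c

theorem exists_mem_child {k : ℕ} {t : Fin k → Fin b} {x : EuclideanSpace ℝ (Fin d)}
    (hx : x ∈ S.cell k t) : ∃ c : Fin b, x ∈ S.cell (k + 1) (Fin.snoc t c) := by
  rwa [S.cell_eq_iUnion, mem_iUnion] at hx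

theorem cell_succ_subset {k : ℕ} (t : Fin (k + 1) → Fin b) :
    S.cell (k + 1) t ⊆ S.cell k (Fin.init t) := by
  conv_lhs => rw [← Fin.snoc_init_self t]
  exact S.child_subset _ _

theorem cell_subset {k : ℕ} (t : Fin k → Fin b) : S.cell k t ⊆ X := by
  induction k with
  | zero => rw [S.cell_zero]
  | succ k ih => exact (S.cell_succ_subset t).trans (ih _)

theorem exists_mem_cell (k : ℕ) {x : EuclideanSpace ℝ (Fin d)} (hx : x ∈ X) :
    ∃ t, x ∈ S.cell k t := by
  induction k with
  | zero => exact ⟨fun i => i.elim0, by rwa [S.cell_zero]⟩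
  | succ k ih =>
    obtain ⟨t, ht⟩ := ih
    obtain ⟨c, hc⟩ := S.exists_mem_child ht
    exact ⟨_, hc⟩

theorem volume_cell (h_vol : volume X = 1) {k : ℕ} (t : Fin k → Fin b) :
    volume (S.cell k t) = ((b : ℝ≥0∞) ^ k)⁻¹ := by
  induction k with
  | zero => simp [S.cell_zero, h_vol]
  | succ k ih =>
    rw [← Fin.snoc_init_self t, S.volume_child, ih, pow_succ, ENNReal.mul_inv (by simp) (by simp),
      ENNReal.div_eq_inv_mul, mul_comm]

theorem volume_inter_cell {k : ℕ} {t t' : Fin k → Fin b} (h : t ≠ t') :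
    volume (S.cell k t ∩ S.cell k t') = 0 := by
  induction k with
  | zero => exact absurd (Subsingleton.elim _ _) h
  | succ k ih =>
    by_cases h_init : Fin.init t = Fin.init t'
    · have h_last : t (Fin.last k) ≠ t' (Fin.last k) := fun h_last => h <| by
        rw [← Fin.snoc_init_self t, ← Fin.snoc_init_self t', h_init, h_last]
      have h_null := S.volume_inter k (Fin.init t) _ _ h_last
      rwa [Fin.snoc_init_self, h_init, Fin.snoc_init_self] at h_null
    · exact measure_mono_null
        (inter_subset_inter (S.cell_succ_subset t) (S.cell_succ_subset t')) (ih h_init)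

theorem ae_eq_of_mem_cell (k : ℕ) :
    ∀ᵐ x, ∀ t t', x ∈ S.cell k t → x ∈ S.cell k t' → t = t' := by
  refine ae_all_iff.2 fun t => ae_all_iff.2 fun t' => ?_
  by_cases h : t = t'
  · exact .of_forall fun _ _ _ => h
  · filter_upwards [measure_eq_zero_iff_ae_notMem.1 (S.volume_inter_cell h)] with x hx ht ht'
    exact absurd ⟨ht, ht'⟩ hx

theorem ae_indicator_child_eq_ite (k : ℕ) :
    ∀ᵐ x, ∀ t c, x ∈ S.cell (k + 1) (Fin.snoc t c) → ∀ c',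
      (S.cell (k + 1) (Fin.snoc t c')).indicator (1 : EuclideanSpace ℝ (Fin d) → ℝ) x =
        if c' = c then 1 else 0 := by
  filter_upwards [S.ae_eq_of_mem_cell (k + 1)] with x hx t c hc c'
  split_ifs with h
  · rw [h, indicator_of_mem hc, Pi.one_apply]
  · refine indicator_of_notMem (fun hc' => h ?_) _
    simpa using congrFun (hx _ _ hc' hc) (Fin.last k)

end RecursiveSplit

variable (S : RecursiveSplit b X)

theorem psiBlock_eq_indicator_sub (k : ℕ) (t : Fin k → Fin b) (c : Fin b) :
    psiBlock S k t c = fun x =>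
      (S.cell (k + 1) (Fin.snoc t c)).indicator (fun _ => (b : ℝ) ^ (((k : ℝ) + 1) / 2)) x -
        (S.cell k t).indicator (fun _ => (b : ℝ) ^ (((k : ℝ) - 1) / 2)) x := by
  ext x
  classical simp [psiBlock, indicator_apply]

theorem measurable_psiBlock (k : ℕ) (t : Fin k → Fin b) (c : Fin b) :
    Measurable (psiBlock S k t c) := by
  rw [psiBlock_eq_indicator_sub]
  exact (measurable_const.indicator (S.measurableSet_cell _ _)).sub
    (measurable_const.indicator (S.measurableSet_cell _ _))

theorem psiBlock_of_notMem {k : ℕ} {t : Fin k → Fin b} {x : EuclideanSpace ℝ (Fin d)}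
    (h : x ∉ S.cell k t) (c : Fin b) : psiBlock S k t c x = 0 := by
  rw [psiBlock, indicator_of_notMem h, indicator_of_notMem fun h' => h (S.child_subset t c h')]
  simp

theorem rpow_succ_div_two (hb : 0 < b) (k : ℕ) :
    (b : ℝ) ^ (((k : ℝ) + 1) / 2) = b * (b : ℝ) ^ (((k : ℝ) - 1) / 2) := by
  have hb' : (0 : ℝ) < b := by positivity
  rw [mul_comm, ← Real.rpow_add_one hb'.ne']
  congr 1; ring

theorem rpow_succ_div_two_mul_rpow_pred_div_two (hb : 0 < b) (k : ℕ) :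
    (b : ℝ) ^ (((k : ℝ) + 1) / 2) * (b : ℝ) ^ (((k : ℝ) - 1) / 2) = (b : ℝ) ^ k := by
  have hb' : (0 : ℝ) < b := by positivity
  rw [← Real.rpow_add hb', ← Real.rpow_natCast]
  congr 1; ring

theorem integrable_indicator_cell (h_vol : volume X = 1) {k : ℕ} (t : Fin k → Fin b)
    (a : ℝ) : Integrable ((S.cell k t).indicator fun _ => a) :=
  (integrable_indicator_iff (S.measurableSet_cell _ _)).2 <| integrableOn_const <|
    ((measure_mono (S.cell_subset t)).trans_lt (h_vol ▸ ENNReal.one_lt_top)).ne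

theorem integral_indicator_cell (h_vol : volume X = 1) {k : ℕ} (t : Fin k → Fin b) (a : ℝ) :
    ∫ x, (S.cell k t).indicator (fun _ => a) x = ((b : ℝ) ^ k)⁻¹ * a := by
  rw [integral_indicator_const _ (S.measurableSet_cell _ _), Measure.real,
    S.volume_cell h_vol, smul_eq_mul, ENNReal.toReal_inv, ENNReal.toReal_pow,
    ENNReal.toReal_natCast]

theorem integral_psiBlock (h_vol : volume X = 1) (hb : 0 < b) (k : ℕ) (t : Fin k → Fin b)
    (c : Fin b) : ∫ x, psiBlock S k t c x = 0 := by
  rw [psiBlock_eq_indicator_sub, integral_sub (integrable_indicator_cell S h_vol _ _)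
    (integrable_indicator_cell S h_vol _ _), integral_indicator_cell S h_vol,
    integral_indicator_cell S h_vol, rpow_succ_div_two hb, pow_succ]
  field_simp
  ring

theorem abs_psiBlock_eq (hb : 0 < b) (k : ℕ) (t : Fin k → Fin b) (c : Fin b)
    (x : EuclideanSpace ℝ (Fin d)) :
    |psiBlock S k t c x| =
      (S.cell (k + 1) (Fin.snoc t c)).indicator (fun _ => (b : ℝ) ^ (((k : ℝ) + 1) / 2) -
          2 * (b : ℝ) ^ (((k : ℝ) - 1) / 2)) x +
        (S.cell k t).indicator (fun _ => (b : ℝ) ^ (((k : ℝ) - 1) / 2)) x := by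
  have hb' : (1 : ℝ) ≤ b := by exact_mod_cast hb
  have h_pos : (0 : ℝ) < (b : ℝ) ^ (((k : ℝ) - 1) / 2) := by positivity
  have h_le : (b : ℝ) ^ (((k : ℝ) - 1) / 2) ≤ (b : ℝ) ^ (((k : ℝ) + 1) / 2) := by gcongr; linarith
  rw [psiBlock]
  by_cases hx' : x ∈ S.cell k t
  · by_cases hx : x ∈ S.cell (k + 1) (Fin.snoc t c)
    · simp only [hx, hx', indicator_of_mem, Pi.one_apply, mul_one]
      rw [abs_of_nonneg (sub_nonneg.2 h_le)]
      ring
    · simp [hx, hx', abs_of_pos h_pos]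
  · have hx : x ∉ S.cell (k + 1) (Fin.snoc t c) := fun h => hx' (S.child_subset t c h)
    simp [hx, hx']

theorem rpow_mul_integral_abs_psiBlock (h_vol : volume X = 1) (hb : 0 < b) (k : ℕ)
    (t : Fin k → Fin b) (c : Fin b) :
    (b : ℝ) ^ (((k : ℝ) + 1) / 2) * ∫ x, |psiBlock S k t c x| = 2 - 2 / b := by
  simp_rw [abs_psiBlock_eq S hb]
  rw [integral_add (integrable_indicator_cell S h_vol _ _) (integrable_indicator_cell S h_vol _ _),
    integral_indicator_cell S h_vol, integral_indicator_cell S h_vol]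
  have h_mul := rpow_succ_div_two_mul_rpow_pred_div_two hb k
  rw [rpow_succ_div_two hb] at h_mul ⊢
  set β := (b : ℝ) ^ (((k : ℝ) - 1) / 2)
  calc b * β * (((b : ℝ) ^ (k + 1))⁻¹ * (b * β - 2 * β) + ((b : ℝ) ^ k)⁻¹ * β)
      = b * β * β * ((b : ℝ) ^ k)⁻¹ * (2 - 2 / b) := by rw [pow_succ]; field_simp; ring
    _ = 2 - 2 / b := by rw [h_mul, mul_inv_cancel₀ (by positivity), one_mul]

theorem ae_sum_psiBlock_eq_zero (hb : 0 < b) (k : ℕ) (t : Fin k → Fin b) :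
    ∀ᵐ x, ∑ c, psiBlock S k t c x = 0 := by
  filter_upwards [S.ae_indicator_child_eq_ite k] with x h_child
  by_cases hx : x ∈ S.cell k t
  · obtain ⟨c, hc⟩ := S.exists_mem_child hx
    simp only [psiBlock, h_child t c hc, hx, indicator_of_mem, Pi.one_apply,
      Finset.sum_sub_distrib, mul_ite, mul_one, mul_zero, Finset.sum_ite_eq', Finset.mem_univ,
      if_true, Finset.sum_const, Finset.card_univ, Fintype.card_fin, nsmul_eq_mul,
      rpow_succ_div_two hb, sub_self]
  · exact Finset.sum_eq_zero fun c _ => psiBlock_of_notMem S hx c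

/-- Almost every point lies in one cell only, and there the functions `ψ_{ktc'}`, `0 ≤ c' < b`, sum
to zero; so the projection kernel is a multiple of a single basis function. -/
theorem ae_exists_sum_psiBlock_mul_eq (hb : 0 < b) (k : ℕ) :
    ∀ᵐ x, x ∈ X → ∃ t c, ∀ᵐ z, ∑ t', ∑ c', psiBlock S k t' c' z * psiBlock S k t' c' x =
      (b : ℝ) ^ (((k : ℝ) + 1) / 2) * psiBlock S k t c z := by
  filter_upwards [S.ae_eq_of_mem_cell k, S.ae_indicator_child_eq_ite k] with x h_cell h_child hx
  obtain ⟨t, ht⟩ := S.exists_mem_cell k hx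
  obtain ⟨c, hc⟩ := S.exists_mem_child ht
  refine ⟨t, c, (ae_sum_psiBlock_eq_zero S hb k t).mono fun z hz => ?_⟩
  rw [Finset.sum_eq_single_of_mem t (Finset.mem_univ t) fun t' _ h' => Finset.sum_eq_zero
    fun c' _ => by rw [psiBlock_of_notMem S (fun h => h' (h_cell _ _ h ht)), mul_zero]]
  have h_psi : ∀ c', psiBlock S k t c' x =
      (if c' = c then (b : ℝ) ^ (((k : ℝ) + 1) / 2) else 0) - (b : ℝ) ^ (((k : ℝ) - 1) / 2) :=
    fun c' => by simp [psiBlock, h_child t c hc, ht]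
  simp_rw [h_psi, mul_sub]
  rw [Finset.sum_sub_distrib, ← Finset.sum_mul, hz]
  simp [mul_comm]

end Cells

section RectHull

variable {ι : Type*} {A B : Set (ι → ℝ)}

theorem subset_rectHull (hA : Bornology.IsBounded A) : A ⊆ rectHull A := fun _ hx =>
  ⟨fun p => csInf_le (hA.image_eval p).bddBelow (mem_image_of_mem _ hx),
    fun p => le_csSup (hA.image_eval p).bddAbove (mem_image_of_mem _ hx)⟩

theorem rectHull_mono (hB : Bornology.IsBounded B) (hA : A.Nonempty) (h : A ⊆ B) :
    rectHull A ⊆ rectHull B :=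
  Icc_subset_Icc
    (fun p => csInf_le_csInf (hB.image_eval p).bddBelow (hA.image _) (image_mono h))
    fun p => csSup_le_csSup (hB.image_eval p).bddAbove (hA.image _) (image_mono h)

theorem sSup_sub_sInf_le_of_forall_abs_sub_le {A : Set ℝ} {r : ℝ} (hA : A.Nonempty)
    (hr : ∀ x ∈ A, ∀ y ∈ A, |x - y| ≤ r) : sSup A - sInf A ≤ r := by
  rw [← Real.diam_eq (Metric.isBounded_iff.2 ⟨r, hr⟩)]
  exact Metric.diam_le_of_forall_dist_le_of_nonempty hA hr

end RectHull

section CellBox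

variable {s d b : ℕ} {X : Fin s → Set (EuclideanSpace ℝ (Fin d))}

theorem isBounded_prodSet (hX : ∀ j, Bornology.IsBounded (X j)) :
    Bornology.IsBounded (prodSet X) := by
  refine Bornology.forall_isBounded_image_eval_iff.1 fun p => ?_
  refine ((EuclideanSpace.proj (𝕜 := ℝ) p.2).lipschitz.isBounded_image (hX p.1)).subset ?_
  rintro _ ⟨x, hx, rfl⟩
  exact ⟨block x p.1, hx p.1, rfl⟩

variable (S : ∀ j, RecursiveSplit b (X j)) (u : Finset (Fin s)) (κ : u → ℕ)
  (τ : ∀ j : u, Fin (κ j) → Fin b) (γ : u → Fin b)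

theorem cellBox_eq_prodSet : cellBox S u κ τ = prodSet fun j =>
    if h : j ∈ u then (S j).cell (κ ⟨j, h⟩) (τ ⟨j, h⟩) else X j := by
  ext x
  refine ⟨fun hx j => ?_, fun hx => ⟨fun j => by simpa using hx j,
    fun j hj => by simpa [hj] using hx j⟩⟩
  by_cases h : j ∈ u
  · simpa [h] using hx.1 ⟨j, h⟩
  · simpa [h] using hx.2 j h

theorem cellBox_subset : cellBox S u κ τ ⊆ prodSet X := by
  rintro x ⟨hxu, hxc⟩ j
  by_cases h : j ∈ u
  · exact (S j).cell_subset _ (hxu ⟨j, h⟩)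
  · exact hxc j h

theorem volume_cellBox_ne_zero (h_vol : ∀ j, volume (X j) = 1) :
    volume (cellBox S u κ τ) ≠ 0 := by
  rw [cellBox_eq_prodSet, volume_prodSet fun j => by
    split_ifs
    exacts [(S j).measurableSet_cell _ _, (S j).measurableSet]]
  refine Finset.prod_ne_zero_iff.2 fun j _ => ?_
  split_ifs
  · simp [(S j).volume_cell (h_vol j)]
  · simp [h_vol]

theorem nonempty_cellBox (h_vol : ∀ j, volume (X j) = 1) : (cellBox S u κ τ).Nonempty :=
  nonempty_of_measure_ne_zero (volume_cellBox_ne_zero S u κ τ h_vol)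

theorem sSup_sub_sInf_cellBox_le (hX : ∀ j, Bornology.IsBounded (X j))
    (h_vol : ∀ j, volume (X j) = 1) {r : u → ℝ}
    (hr : ∀ j : u, Metric.diam ((S j).cell (κ j) (τ j)) ≤ r j) (p : Fin s × Fin d) (hp : p.1 ∈ u) :
    sSup ((fun x => x p) '' cellBox S u κ τ) - sInf ((fun x => x p) '' cellBox S u κ τ) ≤
      r ⟨p.1, hp⟩ := by
  refine sSup_sub_sInf_le_of_forall_abs_sub_le ((nonempty_cellBox S u κ τ h_vol).image _) ?_
  rintro _ ⟨x, hx, rfl⟩ _ ⟨y, hy, rfl⟩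
  calc |x p - y p| ≤ dist (block x p.1) (block y p.1) :=
        PiLp.norm_apply_le (block x p.1 - block y p.1) p.2
    _ ≤ Metric.diam ((S p.1).cell _ (τ ⟨p.1, hp⟩)) := Metric.dist_le_diam_of_mem
        ((hX p.1).subset ((S p.1).cell_subset _)) (hx.1 ⟨p.1, hp⟩) (hy.1 ⟨p.1, hp⟩)
    _ ≤ r ⟨p.1, hp⟩ := hr ⟨p.1, hp⟩

theorem measurable_psi : Measurable (psi S u κ τ γ) :=
  Finset.measurable_prod _ fun _ _ => (measurable_psiBlock _ _ _ _).comp (measurable_block _)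

theorem exists_bound_psiBlock {Y : Set (EuclideanSpace ℝ (Fin d))} (S : RecursiveSplit b Y) (k : ℕ)
    (t : Fin k → Fin b) (c : Fin b) : ∃ K, ∀ x, |psiBlock S k t c x| ≤ K := by
  refine ⟨|(b : ℝ) ^ (((k : ℝ) + 1) / 2)| + |(b : ℝ) ^ (((k : ℝ) - 1) / 2)|, fun x => ?_⟩
  rw [psiBlock_eq_indicator_sub]
  exact (abs_sub _ _).trans (add_le_add (norm_indicator_le_norm_self (E := ℝ) _ _)
    (norm_indicator_le_norm_self (E := ℝ) _ _))

theorem exists_bound_psi : ∃ K, ∀ x, |psi S u κ τ γ x| ≤ K := by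
  choose K hK using fun j : u => exists_bound_psiBlock (S j) (κ j) (τ j) (γ j)
  refine ⟨∏ j, K j, fun x => ?_⟩
  rw [psi, Finset.abs_prod]
  exact Finset.prod_le_prod (fun _ _ => abs_nonneg _) fun j _ => hK j _

theorem integrableOn_mul_psi {g : Pt s d → ℝ} (hg : IntegrableOn g (prodSet X)) :
    IntegrableOn (fun x => g x * psi S u κ τ γ x) (prodSet X) := by
  obtain ⟨K, hK⟩ := exists_bound_psi S u κ τ γ
  exact Integrable.mul_bdd hg (measurable_psi S u κ τ γ).aestronglyMeasurable (.of_forall hK)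

/-- The factor in the block `j` of the extension by zero of `ψ_{uκτγ}` from `X^{1:s}`. -/
def psiFactor (j : Fin s) : EuclideanSpace ℝ (Fin d) → ℝ :=
  if hj : j ∈ u then psiBlock (S j) (κ ⟨j, hj⟩) (τ ⟨j, hj⟩) (γ ⟨j, hj⟩) else (X j).indicator 1

theorem psiFactor_of_mem {j : Fin s} (hj : j ∈ u) : psiFactor S u κ τ γ j =
    psiBlock (S j) (κ ⟨j, hj⟩) (τ ⟨j, hj⟩) (γ ⟨j, hj⟩) := dif_pos hj

theorem psiFactor_of_notMem {j : Fin s} (hj : j ∉ u) :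
    psiFactor S u κ τ γ j = (X j).indicator 1 := dif_neg hj

theorem prod_psiFactor_of_notMem_cellBox {x : Pt s d} (hx : x ∉ cellBox S u κ τ) :
    ∏ j, psiFactor S u κ τ γ j (block x j) = 0 := by
  rw [cellBox_eq_prodSet] at hx
  obtain ⟨j, hj⟩ := not_forall.1 hx
  refine Finset.prod_eq_zero (Finset.mem_univ j) ?_
  dsimp only at hj
  split_ifs at hj with hju
  · rw [psiFactor_of_mem S u κ τ γ hju, psiBlock_of_notMem _ hj]
  · rw [psiFactor_of_notMem S u κ τ γ hju, indicator_of_notMem hj]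

theorem prod_psiFactor_of_mem_prodSet {x : Pt s d} (hx : x ∈ prodSet X) :
    ∏ j, psiFactor S u κ τ γ j (block x j) = psi S u κ τ γ x := by
  rw [← Finset.prod_subset (Finset.subset_univ u) fun j _ hj => by
    simp [psiFactor_of_notMem S u κ τ γ hj, hx j], ← Finset.prod_coe_sort, psi]
  exact Finset.prod_congr rfl fun j _ => by rw [psiFactor_of_mem S u κ τ γ j.2]

theorem setIntegral_mul_psi (g : Pt s d → ℝ) :
    ∫ x in prodSet X, g x * psi S u κ τ γ x =
      ∫ x, g x * ∏ j, psiFactor S u κ τ γ j (block x j) := by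
  rw [← integral_indicator (measurableSet_prodSet fun j => (S j).measurableSet)]
  congr 1 with x
  by_cases hx : x ∈ prodSet X
  · rw [indicator_of_mem hx, prod_psiFactor_of_mem_prodSet S u κ τ γ hx]
  · rw [indicator_of_notMem hx, prod_psiFactor_of_notMem_cellBox S u κ τ γ
      fun h => hx (cellBox_subset S u κ τ h), mul_zero]

theorem integrable_psiFactor (h_vol : ∀ j, volume (X j) = 1) (j : Fin s) :
    Integrable (psiFactor S u κ τ γ j) := by
  by_cases hj : j ∈ u
  · rw [psiFactor_of_mem S u κ τ γ hj, psiBlock_eq_indicator_sub]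
    exact (integrable_indicator_cell _ (h_vol j) _ _).sub
      (integrable_indicator_cell _ (h_vol j) _ _)
  · rw [psiFactor_of_notMem S u κ τ γ hj]
    exact (integrable_indicator_iff (S j).measurableSet).2 (integrableOn_const (by simp [h_vol]))

theorem prod_rpow_mul_integral_abs_prod_psiFactor (h_vol : ∀ j, volume (X j) = 1) (hb : 0 < b) :
    (∏ j : u, (b : ℝ) ^ (((κ j : ℝ) + 1) / 2)) *
      ∫ x : Pt s d, |∏ j, psiFactor S u κ τ γ j (block x j)| = (2 - 2 / b) ^ u.card := by
  have h_compl (j : Fin s) (hj : j ∉ u) : ∫ z, |psiFactor S u κ τ γ j z| = 1 := by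
    have h_abs (z) : |psiFactor S u κ τ γ j z| = (X j).indicator 1 z := by
      rw [psiFactor_of_notMem S u κ τ γ hj]
      exact abs_of_nonneg (indicator_nonneg (fun _ _ => zero_le_one) z)
    simp_rw [h_abs]
    rw [integral_indicator_one (S j).measurableSet, Measure.real, h_vol, ENNReal.toReal_one]
  simp_rw [Finset.abs_prod]
  rw [integral_prod_block fun j z => |psiFactor S u κ τ γ j z|,
    ← Finset.prod_subset (Finset.subset_univ u) fun j _ hj => h_compl j hj,
    ← Finset.prod_coe_sort u fun j => ∫ z, |psiFactor S u κ τ γ j z|, ← Finset.prod_mul_distrib,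
    Finset.prod_congr rfl fun j _ => by
      rw [psiFactor_of_mem S u κ τ γ j.2, rpow_mul_integral_abs_psiBlock _ (h_vol j) hb]]
  simp

theorem setIntegral_mul_psi_eq_zero (h_vol : ∀ j, volume (X j) = 1) (hb : 0 < b) {j : Fin s}
    (hj : j ∈ u) {H : Pt s d → ℝ} (hH : DependsOn H (↑(coords d {j}))ᶜ) :
    ∫ x in prodSet X, H x * psi S u κ τ γ x = 0 := by
  rw [setIntegral_mul_psi]
  refine integral_mul_prod_block_eq_zero ?_ hH
  rw [psiFactor_of_mem S u κ τ γ hj, integral_psiBlock _ (h_vol j) hb]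

end CellBox

section CoverSets

variable {s d : ℕ}

theorem mem_coverSets {u : Finset (Fin s)} {T : Finset (Fin s × Fin d)} :
    T ∈ coverSets d u ↔ T ⊆ coords d u ∧ ∀ j ∈ u, ∃ i, (j, i) ∈ T := by
  simp [coverSets]

theorem card_coverSets_le (d : ℕ) (u : Finset (Fin s)) :
    ((coverSets d u).card : ℝ) ≤ (2 ^ d - 1) ^ u.card := by
  have h_le : (coverSets d u).card ≤
      (Fintype.piFinset fun _ : u => (Finset.univ : Finset (Finset (Fin d))).erase ∅).card := by
    refine Finset.card_le_card_of_injOn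
      (fun T (j : u) => Finset.univ.filter fun i => (j.1, i) ∈ T) (fun T hT => ?_)
      fun T hT T' hT' h => ?_
    · refine Finset.mem_coe.2 (Fintype.mem_piFinset.2 fun j => ?_)
      obtain ⟨i, hi⟩ := (mem_coverSets.1 hT).2 j j.2
      exact Finset.mem_erase.2
        ⟨Finset.ne_empty_of_mem (a := i) (by simpa using hi), Finset.mem_univ _⟩
    · ext ⟨j, i⟩
      by_cases hj : j ∈ u
      · simpa using congrArg (i ∈ ·) (congrFun h ⟨j, hj⟩)
      · exact iff_of_false (fun h => hj (mem_coords.1 ((mem_coverSets.1 hT).1 h)))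
          fun h => hj (mem_coords.1 ((mem_coverSets.1 hT').1 h))
  rw [Fintype.card_piFinset, Finset.prod_const, Finset.card_erase_of_mem (Finset.mem_univ _),
    Finset.card_univ, Finset.card_univ, Fintype.card_finset, Fintype.card_fin,
    Fintype.card_coe] at h_le
  calc ((coverSets d u).card : ℝ) ≤ ((2 ^ d - 1) ^ u.card : ℕ) := by exact_mod_cast h_le
    _ = (2 ^ d - 1) ^ u.card := by
      rw [Nat.cast_pow, Nat.cast_sub Nat.one_le_two_pow]; simp

theorem prod_le_prod_of_mem_coverSets {u : Finset (Fin s)} {L : Fin s × Fin d → ℝ} {C : ℝ}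
    {β : u → ℝ} (hL : ∀ p, 0 ≤ L p) (hC : 1 ≤ C) (hβ : ∀ j, 0 ≤ β j) (hβ' : ∀ j, β j ≤ 1)
    (h : ∀ p (hp : p.1 ∈ u), L p ≤ C * β ⟨p.1, hp⟩) {T : Finset (Fin s × Fin d)}
    (hT : T ∈ coverSets d u) : ∏ p ∈ T, L p ≤ ∏ j, (C ^ d * β j) := by
  obtain ⟨hTu, h_cover⟩ := mem_coverSets.1 hT
  rw [← Finset.prod_fiberwise_of_maps_to (t := u) (g := Prod.fst)
    fun p hp => mem_coords.1 (hTu hp), ← Finset.prod_coe_sort]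
  refine Finset.prod_le_prod (fun j _ => Finset.prod_nonneg fun p _ => hL p) fun j _ => ?_
  obtain ⟨i, hi⟩ := h_cover j j.2
  have h_pos : (T.filter fun p => p.1 = j.1).card ≠ 0 :=
    Finset.card_ne_zero_of_mem (a := (j.1, i)) (by simp [hi])
  have h_card : (T.filter fun p => p.1 = j.1).card ≤ d := by
    calc _ ≤ (({j.1} : Finset (Fin s)) ×ˢ (Finset.univ : Finset (Fin d))).card :=
          Finset.card_le_card fun p hp =>
            Finset.mem_product.2 ⟨by simpa using (Finset.mem_filter.1 hp).2, Finset.mem_univ _⟩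
      _ = d := by simp
  calc ∏ p ∈ T with p.1 = j.1, L p ≤ ∏ p ∈ T with p.1 = j.1, (C * β j) := by
        refine Finset.prod_le_prod (fun p _ => hL p) fun p hp => ?_
        have hpj := (Finset.mem_filter.1 hp).2
        exact (h p (hpj ▸ j.2)).trans_eq (by simp only [hpj])
    _ = C ^ (T.filter fun p => p.1 = j.1).card * β j ^ (T.filter fun p => p.1 = j.1).card := by
        rw [Finset.prod_const, mul_pow]
    _ ≤ C ^ d * β j := mul_le_mul (pow_le_pow_right₀ hC h_card)
        (pow_le_of_le_one (hβ j) (hβ' j) h_pos) (pow_nonneg (hβ j) _) (by positivity)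

theorem sum_coverSets_prod_le {u : Finset (Fin s)} {L : Fin s × Fin d → ℝ} {C : ℝ}
    {β : u → ℝ} (hL : ∀ p, 0 ≤ L p) (hC : 1 ≤ C) (hβ : ∀ j, 0 ≤ β j) (hβ' : ∀ j, β j ≤ 1)
    (h : ∀ p (hp : p.1 ∈ u), L p ≤ C * β ⟨p.1, hp⟩) :
    ∑ T ∈ coverSets d u, ∏ p ∈ T, L p ≤ (2 ^ d - 1) ^ u.card * ∏ j, (C ^ d * β j) :=
  calc ∑ T ∈ coverSets d u, ∏ p ∈ T, L p
      ≤ (coverSets d u).card * ∏ j, (C ^ d * β j) := by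
        rw [← nsmul_eq_mul]
        exact Finset.sum_le_card_nsmul _ _ _ fun T hT =>
          prod_le_prod_of_mem_coverSets hL hC hβ hβ' h hT
    _ ≤ _ := mul_le_mul_of_nonneg_right (card_coverSets_le d u)
        (Finset.prod_nonneg fun j _ => mul_nonneg (by positivity) (hβ j))

end CoverSets

section CoefficientBound

variable {s d b : ℕ} {X : Fin s → Set (EuclideanSpace ℝ (Fin d))}
  (S : ∀ j, RecursiveSplit b (X j)) (u : Finset (Fin s)) (κ : u → ℕ)

theorem sum_psi_mul_psi (x z : Pt s d) :
    ∑ τ, ∑ γ, psi S u κ τ γ z * psi S u κ τ γ x = ∏ j : u, ∑ t, ∑ c,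
      psiBlock (S j) (κ j) t c (block z j) * psiBlock (S j) (κ j) t c (block x j) := by
  simp only [Finset.prod_univ_sum, Fintype.piFinset_univ, psi, Finset.prod_mul_distrib]

theorem nu_eq_setIntegral {g : Pt s d → ℝ} (hg : IntegrableOn g (prodSet X)) (x : Pt s d) :
    nu S g u κ x =
      ∫ z in prodSet X, g z * ∑ τ, ∑ γ, psi S u κ τ γ z * psi S u κ τ γ x := by
  have h_int (τ γ) : IntegrableOn (fun z => g z * (psi S u κ τ γ z * psi S u κ τ γ x))
      (prodSet X) := by
    simpa only [IntegrableOn, mul_assoc] using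
      Integrable.mul_const (integrableOn_mul_psi S u κ τ γ hg) (psi S u κ τ γ x)
  simp_rw [Finset.mul_sum]
  rw [integral_finsetSum _ fun τ _ => integrable_finsetSum _ fun γ _ => h_int τ γ]
  refine Finset.sum_congr rfl fun τ _ => ?_
  rw [integral_finsetSum _ fun γ _ => h_int τ γ]
  simp_rw [← mul_assoc, integral_mul_const]

theorem ae_exists_nu_eq (hb : 0 < b) {g : Pt s d → ℝ} (hg : IntegrableOn g (prodSet X)) :
    ∀ᵐ x, x ∈ prodSet X → ∃ τ γ, nu S g u κ x =
      (∏ j : u, (b : ℝ) ^ (((κ j : ℝ) + 1) / 2)) * ∫ z in prodSet X, g z * psi S u κ τ γ z := by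
  have h_kernel := ae_all_iff.2 fun j : u =>
    ae_block (s := s) (ae_exists_sum_psiBlock_mul_eq (S j) hb (κ j)) j.1
  filter_upwards [h_kernel] with x hx hxX
  choose τ γ hτγ using fun j => hx j (hxX j)
  refine ⟨τ, γ, ?_⟩
  rw [nu_eq_setIntegral S u κ hg, ← integral_const_mul]
  refine integral_congr_ae (ae_restrict_of_ae ?_)
  filter_upwards [ae_all_iff.2 fun j => ae_block (hτγ j) j.1] with z hz
  rw [sum_psi_mul_psi, Finset.prod_congr rfl fun j _ => hz j, Finset.prod_mul_distrib, psi]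
  ring

theorem nu_congr {f g : Pt s d → ℝ}
    (h : ∀ τ γ, ∫ x in prodSet X, f x * psi S u κ τ γ x =
      ∫ x in prodSet X, g x * psi S u κ τ γ x) : nu S f u κ = nu S g u κ := by
  ext x
  simp only [nu, h]

theorem exists_subset_compl_coords_singleton {u : Finset (Fin s)} {w : Finset (Fin s × Fin d)}
    (hw : w ⊆ coords d u) (hw' : w ∉ coverSets d u) :
    ∃ j ∈ u, (↑w ∪ (↑(coords d u))ᶜ : Set (Fin s × Fin d)) ⊆ (↑(coords d {j}))ᶜ := by
  obtain ⟨j, hj, hjw⟩ : ∃ j ∈ u, ∀ i, (j, i) ∉ w := by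
    simpa only [mem_coverSets, hw, true_and, not_forall, not_exists, exists_prop] using hw'
  refine ⟨j, hj, union_subset (fun p hp hpj => ?_) fun p hp hpj => hp ?_⟩
  · obtain rfl : p.1 = j := by simpa [mem_coords] using hpj
    exact hjw p.2 hp
  · obtain rfl : p.1 = j := by simpa [mem_coords] using hpj
    exact mem_coords.2 hj

variable (τ : ∀ j : u, Fin (κ j) → Fin b) (γ : u → Fin b)

theorem abs_setIntegral_mul_psi_le (hb : 0 < b) (hX : ∀ j, Bornology.IsBounded (X j))
    (h_vol : ∀ j, volume (X j) = 1) {G : Finset (Fin s × Fin d) → Pt s d → ℝ}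
    (hG : IsIntegralFamily (rectHull (cellBox S u κ τ)) G) {M : ℝ} (hM0 : 0 ≤ M)
    (hM : ∀ᵐ x, ∀ T ∈ coverSets d u, x ∈ rectHull (cellBox S u κ τ) → |G T x| ≤ M) :
    (∏ j : u, (b : ℝ) ^ (((κ j : ℝ) + 1) / 2)) *
      |∫ x in prodSet X, G ∅ x * psi S u κ τ γ x| ≤
    M * (∑ T ∈ coverSets d u, ∏ p ∈ T, (sSup ((fun x => x p) '' cellBox S u κ τ) -
      sInf ((fun x => x p) '' cellBox S u κ τ))) * (2 - 2 / b) ^ u.card := by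
  have h_sub : cellBox S u κ τ ⊆ rectHull (cellBox S u κ τ) :=
    subset_rectHull ((isBounded_prodSet hX).subset (cellBox_subset S u κ τ))
  have h_box : volume (rectHull (cellBox S u κ τ)) ≠ 0 := fun h =>
    volume_cellBox_ne_zero S u κ τ h_vol (measure_mono_null h_sub h)
  have h_coeff := hG.abs_integral_mul_le (𝒯 := coverSets d u) (W := coords d u) h_box
    (integrable_prod_block (integrable_psiFactor S u κ τ γ h_vol))
    (fun x hx => prod_psiFactor_of_notMem_cellBox S u κ τ γ fun h => hx (h_sub h))
    (Finset.filter_subset _ _) (fun w hw hw' H hH => ?_) hM0 hM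
  · rw [setIntegral_mul_psi, ← prod_rpow_mul_integral_abs_prod_psiFactor S u κ τ γ h_vol hb]
    refine (mul_le_mul_of_nonneg_left h_coeff
      (Finset.prod_nonneg fun _ _ => by positivity)).trans_eq ?_
    ring
  · obtain ⟨j, hj, h_dep⟩ := exists_subset_compl_coords_singleton hw hw'
    rw [← setIntegral_mul_psi]
    exact setIntegral_mul_psi_eq_zero S u κ τ γ h_vol hb hj fun x y h =>
      hH fun p hp => h p (h_dep hp)

end CoefficientBound

section VarianceBound

variable {s d b : ℕ}

theorem prod_mul_rpow_eq (hb : 0 < b) {u : Finset (Fin s)} (κ : u → ℕ) (a : ℝ) :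
    ∏ j, (a * (b : ℝ) ^ (-(κ j : ℝ) / (d : ℝ))) =
      a ^ u.card * (b : ℝ) ^ (-((∑ j, κ j : ℕ) : ℝ) / (d : ℝ)) := by
  rw [Finset.prod_mul_distrib, ← Real.rpow_sum_of_pos (by positivity), ← Finset.sum_div,
    Finset.sum_neg_distrib, Nat.cast_sum, Finset.prod_const, Finset.card_univ, Fintype.card_coe]

theorem rpow_neg_two_mul_div (hb : 0 < b) (k : ℝ) :
    (b : ℝ) ^ (-2 * k / (d : ℝ)) = ((b : ℝ) ^ (-k / (d : ℝ))) ^ 2 := by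
  rw [← Real.rpow_mul_natCast (by positivity)]
  congr 1
  push_cast
  ring

theorem one_le_two_sub_two_div (hb : 2 ≤ b) : (1 : ℝ) ≤ 2 - 2 / b := by
  have h : 2 / (b : ℝ) ≤ 1 := div_le_one_of_le₀ (by exact_mod_cast hb) (by positivity)
  linarith

variable {X : Fin s → Set (EuclideanSpace ℝ (Fin d))}
  (S : ∀ j, RecursiveSplit b (X j)) (u : Finset (Fin s)) (κ : u → ℕ)

theorem ae_abs_nu_le (hb : 2 ≤ b) (hX : ∀ j, Bornology.IsBounded (X j))
    (h_vol : ∀ j, volume (X j) = 1) {C : ℝ} (hC : 1 ≤ C)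
    (h_diam : ∀ j k (t : Fin k → Fin b),
      Metric.diam ((S j).cell k t) ≤ C * (b : ℝ) ^ (-(k : ℝ) / (d : ℝ)))
    {G : Finset (Fin s × Fin d) → Pt s d → ℝ} (hG : IsIntegralFamily (rectHull (prodSet X)) G)
    {M : ℝ} (hM0 : 0 ≤ M) (hM : ∀ᵐ x, ∀ T ∈ coverSets d u,
      (∃ τ, x ∈ rectHull (cellBox S u κ τ)) → |G T x| ≤ M)
    (hG_int : IntegrableOn (G ∅) (prodSet X)) :
    ∀ᵐ x, x ∈ prodSet X → |nu S (G ∅) u κ x| ≤ M * (((2 ^ d - 1) * C ^ d * (2 - 2 / b)) ^ u.card *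
      (b : ℝ) ^ (-((∑ j, κ j : ℕ) : ℝ) / (d : ℝ))) := by
  have hb0 : 0 < b := by omega
  filter_upwards [ae_exists_nu_eq S u κ hb0 hG_int] with x hx hxX
  obtain ⟨τ, γ, h_nu⟩ := hx hxX
  have h_coeff := abs_setIntegral_mul_psi_le S u κ τ γ hb0 hX h_vol
    (hG.mono (rectHull_mono (isBounded_prodSet hX) (nonempty_cellBox S u κ τ h_vol)
      (cellBox_subset S u κ τ))) hM0 (hM.mono fun x hx T hT hxτ => hx T hT ⟨τ, hxτ⟩)
  have h_sides := sum_coverSets_prod_le (L := fun p => sSup ((fun x => x p) '' cellBox S u κ τ) -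
      sInf ((fun x => x p) '' cellBox S u κ τ)) (β := fun j => (b : ℝ) ^ (-(κ j : ℝ) / (d : ℝ)))
    (fun p => sub_nonneg.2 (Real.sInf_le_sSup _
      (((isBounded_prodSet hX).subset (cellBox_subset S u κ τ)).image_eval p).bddBelow
      (((isBounded_prodSet hX).subset (cellBox_subset S u κ τ)).image_eval p).bddAbove)) hC
    (fun j => by positivity)
    (fun j => Real.rpow_le_one_of_one_le_of_nonpos (by exact_mod_cast hb0)
      (div_nonpos_of_nonpos_of_nonneg (neg_nonpos.2 (Nat.cast_nonneg _)) (Nat.cast_nonneg _)))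
    (sSup_sub_sInf_cellBox_le S u κ τ hX h_vol fun j => h_diam j _ _)
  have h_two : (0 : ℝ) ≤ 2 - 2 / b := zero_le_one.trans (one_le_two_sub_two_div hb)
  rw [h_nu, abs_mul, abs_of_nonneg (Finset.prod_nonneg fun _ _ => by positivity)]
  calc _ ≤ _ := h_coeff
    _ ≤ M * ((2 ^ d - 1) ^ u.card * ∏ j, (C ^ d * (b : ℝ) ^ (-(κ j : ℝ) / (d : ℝ)))) *
        (2 - 2 / b) ^ u.card := by gcongr
    _ = _ := by rw [prod_mul_rpow_eq hb0, mul_pow, mul_pow]; ring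

theorem sigmaSq_le_sq (h_vol : ∀ j, volume (X j) = 1) {f : Pt s d → ℝ} {a : ℝ}
    (h : ∀ᵐ x, x ∈ prodSet X → |nu S f u κ x| ≤ a) : sigmaSq S f u κ ≤ a ^ 2 := by
  have h_meas := measurableSet_prodSet fun j => (S j).measurableSet
  have h_one := volume_prodSet_eq_one (fun j => (S j).measurableSet) h_vol
  have h_sq : ∀ᵐ x ∂volume.restrict (prodSet X), ‖nu S f u κ x ^ 2‖ ≤ a ^ 2 := by
    refine (ae_restrict_iff' h_meas).2 (h.mono fun x hx hxX => ?_)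
    rw [norm_pow]
    exact pow_le_pow_left₀ (norm_nonneg _) (hx hxX) 2
  calc sigmaSq S f u κ ≤ ‖sigmaSq S f u κ‖ := le_abs_self _
    _ ≤ a ^ 2 * volume.real (prodSet X) :=
        norm_setIntegral_le_of_norm_le_const_ae (by simp [h_one]) h_sq
    _ = a ^ 2 := by rw [Measure.real, h_one, ENNReal.toReal_one, mul_one]

theorem ae_abs_mixedPartial_le {F : Pt s d → ℝ} (h : hNorm S u κ F ≠ ⊤) :
    ∀ᵐ x, ∀ T ∈ coverSets d u, (∃ τ, x ∈ rectHull (cellBox S u κ τ)) →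
      |mixedPartial T F x| ≤ (hNorm S u κ F).toReal := by
  have h_ae : ∀ᵐ x ∂(volume.restrict (⋃ τ, rectHull (cellBox S u κ τ))),
      ‖hMax u F x‖ₑ ≤ hNorm S u κ F := by
    rw [hNorm, eLpNorm_exponent_top]
    exact ae_le_eLpNormEssSup
  rw [ae_restrict_iff' (MeasurableSet.iUnion fun τ =>
    show MeasurableSet (rectHull _) from measurableSet_Icc)] at h_ae
  filter_upwards [h_ae] with x hx T hT hxR
  have h_max := hx (mem_iUnion.2 hxR)
  rw [← ofReal_norm, ENNReal.ofReal_le_iff_le_toReal h] at h_max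
  calc |mixedPartial T F x| ≤ hMax u F x := NNReal.coe_le_coe.2
        (Finset.le_sup (f := fun v => ‖mixedPartial v F x‖₊) hT)
    _ ≤ _ := (le_abs_self _).trans h_max

theorem ofReal_sigmaSq_le_of_isIntegralFamily (hd : 1 ≤ d) (hb : 2 ≤ b)
    (hX : ∀ j, Bornology.IsBounded (X j)) (h_vol : ∀ j, volume (X j) = 1) {C : ℝ} (hC : 1 ≤ C)
    (h_diam : ∀ j k (t : Fin k → Fin b),
      Metric.diam ((S j).cell k t) ≤ C * (b : ℝ) ^ (-(k : ℝ) / (d : ℝ)))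
    {f F : Pt s d → ℝ} {G : Finset (Fin s × Fin d) → Pt s d → ℝ}
    (hG : IsIntegralFamily (rectHull (prodSet X)) G) (hG_int : IntegrableOn (G ∅) (prodSet X))
    (h_coeff : ∀ τ γ, ∫ x in prodSet X, f x * psi S u κ τ γ x =
      ∫ x in prodSet X, G ∅ x * psi S u κ τ γ x)
    (hF : ∀ T, ∀ᵐ x, x ∈ rectHull (prodSet X) → mixedPartial T F x = G T x) :
    ENNReal.ofReal (sigmaSq S f u κ) ≤
      ENNReal.ofReal ((((2 ^ d - 1) * C ^ d * (2 - 2 / (b : ℝ))) ^ 2) ^ u.card *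
        (b : ℝ) ^ (-2 * ((∑ j, κ j : ℕ) : ℝ) / (d : ℝ))) * hNorm S u κ F ^ 2 := by
  by_cases h_top : hNorm S u κ F = ⊤
  · have h_two : (0 : ℝ) < 2 - 2 / b := zero_lt_one.trans_le (one_le_two_sub_two_div hb)
    have h_pow : (0 : ℝ) < 2 ^ d - 1 := sub_pos.2 (one_lt_pow₀ one_lt_two (by omega))
    have h_pos : 0 < ENNReal.ofReal ((((2 ^ d - 1) * C ^ d * (2 - 2 / (b : ℝ))) ^ 2) ^ u.card *
        (b : ℝ) ^ (-2 * ((∑ j, κ j : ℕ) : ℝ) / (d : ℝ))) := ENNReal.ofReal_pos.2 (by positivity)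
    rw [h_top, ENNReal.top_pow two_ne_zero, ENNReal.mul_top h_pos.ne']
    exact le_top
  have hM : ∀ᵐ x, ∀ T ∈ coverSets d u, (∃ τ, x ∈ rectHull (cellBox S u κ τ)) →
      |G T x| ≤ (hNorm S u κ F).toReal := by
    filter_upwards [ae_abs_mixedPartial_le S u κ h_top, ae_all_iff.2 hF] with x hx hx' T hT hxR
    obtain ⟨τ, hτ⟩ := hxR
    rw [← hx' T (rectHull_mono (isBounded_prodSet hX) (nonempty_cellBox S u κ τ h_vol)
      (cellBox_subset S u κ τ) hτ)]
    exact hx T hT ⟨τ, hτ⟩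
  have h_nu := ae_abs_nu_le S u κ hb hX h_vol hC h_diam hG ENNReal.toReal_nonneg hM hG_int
  rw [← nu_congr S u κ h_coeff] at h_nu
  refine (ENNReal.ofReal_le_ofReal (sigmaSq_le_sq S u κ h_vol h_nu)).trans_eq ?_
  rw [mul_pow, mul_comm, ENNReal.ofReal_mul' (sq_nonneg _),
    ENNReal.ofReal_pow ENNReal.toReal_nonneg, ENNReal.ofReal_toReal h_top,
    rpow_neg_two_mul_div (by omega), mul_pow, ← pow_mul, ← pow_mul, mul_comm u.card]

end VarianceBound

section SmoothFunctions

variable {ι : Type*} [DecidableEq ι] {A : Set (ι → ℝ)}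

theorem SmoothOn.continuousOn {f : (ι → ℝ) → ℝ} (hf : SmoothOn A f) : ContinuousOn f A := by
  obtain ⟨D, h_eq, h_cont, -⟩ := hf
  exact (h_cont ∅).congr h_eq.symm

theorem SmoothOn.sub {f g : (ι → ℝ) → ℝ} (hf : SmoothOn A f) (hg : SmoothOn A g) :
    SmoothOn A (fun x => f x - g x) := by
  obtain ⟨D, h_eq, h_cont, h_deriv⟩ := hf
  obtain ⟨D', h_eq', h_cont', h_deriv'⟩ := hg
  exact ⟨fun v x => D v x - D' v x, fun x hx => by simp only [h_eq hx, h_eq' hx],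
    fun v => (h_cont v).sub (h_cont' v),
    fun v p hp x hx => (h_deriv v p hp x hx).sub (h_deriv' v p hp x hx)⟩

theorem SmoothOn.sum {α : Type*} {I : Finset α} {f : α → (ι → ℝ) → ℝ}
    (hf : ∀ i ∈ I, SmoothOn A (f i)) : SmoothOn A (fun x => ∑ i ∈ I, f i x) := by
  choose! D h_eq h_cont h_deriv using hf
  exact ⟨fun v x => ∑ i ∈ I, D i v x,
    fun x hx => Finset.sum_congr rfl fun i hi => h_eq i hi hx,
    fun v => continuousOn_finsetSum _ fun i hi => h_cont i hi v,
    fun v p hp x hx => HasDerivWithinAt.fun_sum fun i hi => h_deriv i hi v p hp x hx⟩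

end SmoothFunctions

section BlockIntegral

variable {s d : ℕ} {X : Fin s → Set (EuclideanSpace ℝ (Fin d))} {u : Finset (Fin s)}
  {g g' : Pt s d → ℝ}

/-- The integral over the blocks outside `u`, as a function of all coordinates that ignores those
blocks of its argument. -/
def blockIntegral (X : Fin s → Set (EuclideanSpace ℝ (Fin d))) (u : Finset (Fin s))
    (g : Pt s d → ℝ) (x : Pt s d) : ℝ :=
  ∫ y in sliceSet X uᶜ, g (hybrid (coords d uᶜ) x y)

theorem dependsOn_blockIntegral (X : Fin s → Set (EuclideanSpace ℝ (Fin d))) (u : Finset (Fin s))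
    (g : Pt s d → ℝ) : DependsOn (blockIntegral X u g) (coords d u) := fun x x' h => by
  simp only [blockIntegral, hybrid_congr fun p hp => h p (notMem_coords_compl.1 hp)]

theorem blockIntegral_mul_of_dependsOn {ψ : Pt s d → ℝ} (hψ : DependsOn ψ (coords d u))
    (x : Pt s d) : blockIntegral X u (fun x => g x * ψ x) x = blockIntegral X u g x * ψ x := by
  have h_const (y) : ψ (hybrid (coords d uᶜ) x y) = ψ x :=
    hψ fun p hp => hybrid_of_notMem (notMem_coords_compl.2 hp) x y
  simp only [blockIntegral, h_const, integral_mul_const]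

theorem anova_eq_blockIntegral (f : Pt s d → ℝ) (u : Finset (Fin s)) :
    anova X f u = blockIntegral X u fun x => f x - ∑ v ∈ u.ssubsets, anova X f v x := by
  ext x
  have h_slice : {y : coords d uᶜ → ℝ | ∀ j ∉ u, block (hybrid (coords d uᶜ) x y) j ∈ X j} =
      sliceSet X uᶜ := by
    ext y
    simp [mem_sliceSet_iff x]
  rw [anova, blockIntegral, h_slice]
  refine integral_congr_ae (.of_forall fun y => congrArg (f _ - ·) ?_)
  exact Finset.sum_attach u.ssubsets fun v => anova X f v (hybrid (coords d uᶜ) x y)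

theorem dependsOn_anova (f : Pt s d → ℝ) (u : Finset (Fin s)) :
    DependsOn (anova X f u) (coords d u) := by
  rw [anova_eq_blockIntegral]
  exact dependsOn_blockIntegral X u _

theorem continuousOn_hybrid_sliceSet (hg : ContinuousOn g (prodSet X)) {x : Pt s d}
    (hx : x ∈ prodSet X) : ContinuousOn (fun y => g (hybrid (coords d u) x y)) (sliceSet X u) :=
  hg.comp (continuous_hybrid_right _ x).continuousOn fun _ hy => hybrid_mem_prodSet hx hy

theorem hasDerivWithinAt_hybrid_update {p : Fin s × Fin d} (hp : p ∉ coords d u)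
    (hd : ∀ x ∈ prodSet X, HasPartialWithin (prodSet X) p g (g' x) x) {x : Pt s d}
    {y : coords d u → ℝ} (hy : y ∈ sliceSet X u) {r : ℝ}
    (hr : Function.update x p r ∈ prodSet X) :
    HasDerivWithinAt (fun t => g (hybrid (coords d u) (Function.update x p t) y))
      (g' (hybrid (coords d u) (Function.update x p r) y))
      {t | Function.update x p t ∈ prodSet X} r := by
  have h_partial := hd _ (hybrid_mem_prodSet hr hy)
  simp only [HasPartialWithin, hybrid_of_notMem hp, Function.update_self,
    hybrid_update_of_notMem hp, Function.update_idem] at h_partial ⊢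
  refine h_partial.mono fun t ht => ?_
  simpa only [mem_ofPred_eq, ← hybrid_update_of_notMem hp] using hybrid_mem_prodSet ht hy

variable (hX : ∀ j, MeasurableSet (X j))
include hX

theorem indicator_blockIntegral (φ : Pt s d → ℝ) (x : Pt s d) :
    (prodSet X).indicator (blockIntegral X u φ) x =
      (sliceSet X uᶜ).indicator 1 (splitEquiv (coords d uᶜ) x).1 *
        ∫ y, (prodSet X).indicator φ (hybrid (coords d uᶜ) x y) := by
  have h_restrict : hybrid (coords d uᶜ) x (splitEquiv (coords d uᶜ) x).1 = x := by
    rw [← splitEquiv_symm_eq_hybrid, Prod.mk.eta, MeasurableEquiv.symm_apply_apply]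
  have h_mem : x ∈ prodSet X ↔ (∀ j ∉ uᶜ, block x j ∈ X j) ∧
      (splitEquiv (coords d uᶜ) x).1 ∈ sliceSet X uᶜ := by
    rw [← hybrid_mem_prodSet_iff, h_restrict]
  by_cases hy : (splitEquiv (coords d uᶜ) x).1 ∈ sliceSet X uᶜ
  swap
  · rw [indicator_of_notMem fun h => hy (h_mem.1 h).2, indicator_of_notMem hy, zero_mul]
  rw [indicator_of_mem hy, Pi.one_apply, one_mul]
  by_cases hx : ∀ j ∉ uᶜ, block x j ∈ X j
  · have h_preimage : sliceSet X uᶜ = hybrid (coords d uᶜ) x ⁻¹' prodSet X :=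
      ext fun y => (hybrid_mem_prodSet_iff.trans (and_iff_right hx)).symm
    rw [indicator_of_mem (h_mem.2 ⟨hx, hy⟩), blockIntegral,
      ← integral_indicator (measurableSet_sliceSet hX uᶜ), h_preimage]
    rfl
  · have h_zero (y) : (prodSet X).indicator φ (hybrid (coords d uᶜ) x y) = 0 :=
      indicator_of_notMem (fun h => hx (hybrid_mem_prodSet_iff.1 h).1) φ
    simp only [h_zero, integral_zero]
    exact indicator_of_notMem (fun h => hx (h_mem.1 h).1) _

theorem integrable_indicator_comp_splitEquiv_symm {φ : Pt s d → ℝ}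
    (hφ : IntegrableOn φ (prodSet X)) :
    Integrable (fun q => (prodSet X).indicator φ ((splitEquiv (coords d u)).symm q))
      (volume.prod volume) :=
  ((measurePreserving_splitEquiv _).symm.integrable_comp_emb
    (splitEquiv _).symm.measurableEmbedding).2
      ((integrable_indicator_iff (measurableSet_prodSet hX)).2 hφ)

variable (h_vol : ∀ j, volume (X j) = 1)
include h_vol

theorem integrableOn_blockIntegral {φ : Pt s d → ℝ} (hφ : IntegrableOn φ (prodSet X)) :
    IntegrableOn (blockIntegral X u φ) (prodSet X) := by
  have h_slice : Integrable ((sliceSet X uᶜ).indicator (1 : (coords d uᶜ → ℝ) → ℝ)) :=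
    (integrable_indicator_iff (measurableSet_sliceSet hX uᶜ)).2
      (integrableOn_const (by simp [volume_sliceSet_eq_one hX h_vol]))
  have h_rest := (integrable_indicator_comp_splitEquiv_symm (u := uᶜ) hX hφ).integral_prod_right
  rw [← integrable_indicator_iff (measurableSet_prodSet hX)]
  simp_rw [funext (indicator_blockIntegral hX φ)]
  exact ((measurePreserving_splitEquiv _).integrable_comp_emb
    (splitEquiv _).measurableEmbedding).2 (h_slice.mul_prod h_rest)

theorem setIntegral_blockIntegral {φ : Pt s d → ℝ} (hφ : IntegrableOn φ (prodSet X)) :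
    ∫ x in prodSet X, blockIntegral X u φ x = ∫ x in prodSet X, φ x := by
  have h_split := measurePreserving_splitEquiv (coords d uᶜ)
  have h_slice : ∫ y, (sliceSet X uᶜ).indicator (1 : (coords d uᶜ → ℝ) → ℝ) y = 1 := by
    rw [integral_indicator_one (measurableSet_sliceSet hX uᶜ), Measure.real,
      volume_sliceSet_eq_one hX h_vol, ENNReal.toReal_one]
  simp_rw [← integral_indicator (measurableSet_prodSet hX), indicator_blockIntegral hX φ]
  have h_mul := integral_prod_mul (μ := volume) (ν := volume)
    ((sliceSet X uᶜ).indicator (1 : (coords d uᶜ → ℝ) → ℝ))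
    fun z => ∫ y, (prodSet X).indicator φ ((splitEquiv (coords d uᶜ)).symm (y, z))
  calc ∫ x, (sliceSet X uᶜ).indicator 1 (splitEquiv (coords d uᶜ) x).1 *
        ∫ y, (prodSet X).indicator φ (hybrid (coords d uᶜ) x y)
      = ∫ q : (coords d uᶜ → ℝ) × ({p // p ∉ coords d uᶜ} → ℝ), (sliceSet X uᶜ).indicator 1 q.1 *
          ∫ y, (prodSet X).indicator φ ((splitEquiv (coords d uᶜ)).symm (y, q.2)) :=
        h_split.integral_comp' fun q => (sliceSet X uᶜ).indicator 1 q.1 *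
          ∫ y, (prodSet X).indicator φ ((splitEquiv (coords d uᶜ)).symm (y, q.2))
    _ = ∫ z, ∫ y, (prodSet X).indicator φ ((splitEquiv (coords d uᶜ)).symm (y, z)) := by
        rw [Measure.volume_eq_prod, h_mul, h_slice, one_mul]
    _ = ∫ x, (prodSet X).indicator φ x := by
        rw [← integral_prod_symm _ (integrable_indicator_comp_splitEquiv_symm hX hφ),
          ← Measure.volume_eq_prod, h_split.symm.integral_comp']

theorem integrableOn_anova {f : Pt s d → ℝ} (hf : IntegrableOn f (prodSet X))
    (u : Finset (Fin s)) : IntegrableOn (anova X f u) (prodSet X) := by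
  induction u using Finset.strongInduction with
  | H u ih =>
    rw [anova_eq_blockIntegral]
    exact integrableOn_blockIntegral hX h_vol
      (hf.sub (integrable_finsetSum _ fun v hv => ih v (Finset.mem_ssubsets.1 hv)))

variable (hA : IsCompact (prodSet X))
include hA

theorem integrableOn_hybrid_sliceSet (hg : ContinuousOn g (prodSet X)) {x : Pt s d}
    (hx : x ∈ prodSet X) :
    IntegrableOn (fun y => g (hybrid (coords d u) x y)) (sliceSet X u) := by
  obtain ⟨K, hK⟩ := hA.exists_bound_of_continuousOn hg
  have h_meas := measurableSet_sliceSet hX u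
  exact IntegrableOn.of_bound (C := K) (by simp [volume_sliceSet_eq_one hX h_vol])
    ((continuousOn_hybrid_sliceSet hg hx).aestronglyMeasurable h_meas)
    (ae_restrict_of_forall_mem h_meas fun y hy => hK _ (hybrid_mem_prodSet hx hy))

theorem continuousOn_blockIntegral (hg : ContinuousOn g (prodSet X)) :
    ContinuousOn (blockIntegral X u g) (prodSet X) := by
  obtain ⟨K, hK⟩ := hA.exists_bound_of_continuousOn hg
  have h_meas := measurableSet_sliceSet hX uᶜ
  refine continuousOn_of_dominated (bound := fun _ => K)
    (fun x hx => (continuousOn_hybrid_sliceSet hg hx).aestronglyMeasurable h_meas)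
    (fun x hx => ae_restrict_of_forall_mem h_meas fun y hy => hK _ (hybrid_mem_prodSet hx hy))
    (integrableOn_const (by simp [volume_sliceSet_eq_one hX h_vol]))
    (ae_restrict_of_forall_mem h_meas fun y hy => ?_)
  exact hg.comp ((continuous_hybrid _).comp (Continuous.prodMk_left y)).continuousOn
    fun x hx => hybrid_mem_prodSet hx hy

theorem hasPartialWithin_blockIntegral (hg : ContinuousOn g (prodSet X))
    (hg' : ContinuousOn g' (prodSet X)) {p : Fin s × Fin d} (hp : p ∈ coords d u)
    (h_conn : ∀ x, OrdConnected {t | Function.update x p t ∈ prodSet X})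
    (hd : ∀ x ∈ prodSet X, HasPartialWithin (prodSet X) p g (g' x) x) {x : Pt s d}
    (hx : x ∈ prodSet X) :
    HasPartialWithin (prodSet X) p (blockIntegral X u g) (blockIntegral X u g' x) x := by
  obtain ⟨K, hK⟩ := hA.exists_bound_of_continuousOn hg'
  have h_meas := measurableSet_sliceSet hX uᶜ
  have hx' : Function.update x p (x p) ∈ prodSet X := by rwa [Function.update_eq_self]
  set L := {t | Function.update x p t ∈ prodSet X}
  set γ : (coords d uᶜ → ℝ) → ℝ → ℝ := fun y t => g (hybrid (coords d uᶜ) (Function.update x p t) y)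
  have h_deriv (y) (hy : y ∈ sliceSet X uᶜ) {r} (hr : r ∈ L) :
      HasDerivWithinAt (γ y) (g' (hybrid (coords d uᶜ) (Function.update x p r) y)) L r :=
    hasDerivWithinAt_hybrid_update (notMem_coords_compl.2 hp) hd hy hr
  have h_integral (t) (ht : t ∈ L) :
      slope (fun t => blockIntegral X u g (Function.update x p t)) (x p) t =
        ∫ y in sliceSet X uᶜ, slope (γ y) (x p) t := by
    simp only [slope_def_field, blockIntegral]
    rw [integral_div, integral_sub (integrableOn_hybrid_sliceSet hX h_vol hA hg ht)
      (integrableOn_hybrid_sliceSet hX h_vol hA hg hx')]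
  have h_bound (t) (ht : t ∈ L) (y) (hy : y ∈ sliceSet X uᶜ) : ‖slope (γ y) (x p) t‖ ≤ K := by
    have h_seg : uIcc t (x p) ⊆ L := (h_conn x).uIcc_subset ht hx'
    rw [slope_def_field, norm_div]
    exact div_le_of_le_mul₀ (norm_nonneg _) ((norm_nonneg _).trans (hK x hx))
      (Convex.norm_image_sub_le_of_norm_hasDerivWithin_le
        (fun r hr => (h_deriv y hy (h_seg hr)).mono h_seg)
        (fun r hr => hK _ (hybrid_mem_prodSet (h_seg hr) hy)) (convex_uIcc _ _)
        right_mem_uIcc left_mem_uIcc)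
  refine hasDerivWithinAt_iff_tendsto_slope.2 <| Filter.Tendsto.congr' (f₁ := fun t =>
    ∫ y in sliceSet X uᶜ, slope (γ y) (x p) t) ?_ <|
      tendsto_integral_filter_of_dominated_convergence (fun _ => K) ?_ ?_
        (integrableOn_const (by simp [volume_sliceSet_eq_one hX h_vol])) ?_
  · filter_upwards [self_mem_nhdsWithin] with t ht using (h_integral t ht.1).symm
  · filter_upwards [self_mem_nhdsWithin] with t ht
    simp only [slope_def_field]
    exact (((continuousOn_hybrid_sliceSet hg ht.1).sub
      (continuousOn_hybrid_sliceSet hg hx')).div_const _).aestronglyMeasurable h_meas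
  · filter_upwards [self_mem_nhdsWithin] with t ht
    exact ae_restrict_of_forall_mem h_meas (h_bound t ht.1)
  · refine ae_restrict_of_forall_mem h_meas fun y hy => ?_
    simpa only [Function.update_eq_self] using
      hasDerivWithinAt_iff_tendsto_slope.1 (h_deriv y hy hx')

variable (h_conn : ∀ x p, OrdConnected {t | Function.update x p t ∈ prodSet X})
include h_conn

theorem SmoothOn.blockIntegral (hg : SmoothOn (prodSet X) g) :
    SmoothOn (prodSet X) (blockIntegral X u g) := by
  obtain ⟨D, h_eq, h_cont, h_deriv⟩ := hg
  refine ⟨fun v => if v ⊆ coords d u then ScrambledGeometric.blockIntegral X u (D v) else 0,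
    fun x hx => ?_, fun v => ?_, fun v p hp x hx => ?_⟩
  · simp only [Finset.empty_subset, if_true]
    exact setIntegral_congr_fun (measurableSet_sliceSet hX uᶜ) fun y hy =>
      h_eq (hybrid_mem_prodSet hx hy)
  · beta_reduce
    split_ifs
    exacts [continuousOn_blockIntegral hX h_vol hA (h_cont v), continuousOn_const]
  · by_cases hv : v ⊆ coords d u
    swap
    · simp only [hv, Finset.insert_subset_iff, and_false, if_false]
      exact hasDerivWithinAt_const _ _ _
    by_cases hpu : p ∈ coords d u
    · simp only [hv, Finset.insert_subset_iff, hpu, and_self, if_true]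
      exact hasPartialWithin_blockIntegral hX h_vol hA (h_cont v) (h_cont _) hpu
        (fun x => h_conn x p) (h_deriv v p hp) hx
    · simp only [hv, Finset.insert_subset_iff, hpu, false_and, if_true, if_false]
      have h_const (t) : ScrambledGeometric.blockIntegral X u (D v) (Function.update x p t) =
          ScrambledGeometric.blockIntegral X u (D v) x :=
        dependsOn_blockIntegral X u (D v) fun q hq =>
          Function.update_of_ne (ne_of_mem_of_not_mem hq hpu) _ _
      simp only [HasPartialWithin, h_const]
      exact hasDerivWithinAt_const _ _ _

theorem SmoothOn.anova {f : Pt s d → ℝ} (hf : SmoothOn (prodSet X) f) (u : Finset (Fin s)) :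
    SmoothOn (prodSet X) (anova X f u) := by
  induction u using Finset.strongInduction with
  | H u ih =>
    rw [anova_eq_blockIntegral]
    exact SmoothOn.blockIntegral hX h_vol hA h_conn
      (hf.sub (SmoothOn.sum fun v hv => ih v (Finset.mem_ssubsets.1 hv)))

end BlockIntegral

section AnovaCoefficients

variable {s d b : ℕ} {X : Fin s → Set (EuclideanSpace ℝ (Fin d))}
  (S : ∀ j, RecursiveSplit b (X j)) (u : Finset (Fin s)) (κ : u → ℕ)
  (τ : ∀ j : u, Fin (κ j) → Fin b) (γ : u → Fin b)

theorem dependsOn_psi : DependsOn (psi S u κ τ γ) (coords d u) := fun _ _ h =>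
  Finset.prod_congr rfl fun j _ => by rw [block_congr fun i => h (j.1, i) (mem_coords.2 j.2)]

theorem setIntegral_anova_mul_psi_of_ssubset (hb : 2 ≤ b) (h_vol : ∀ j, volume (X j) = 1)
    (f : Pt s d → ℝ) {v : Finset (Fin s)} (hv : v ⊂ u) :
    ∫ x in prodSet X, anova X f v x * psi S u κ τ γ x = 0 := by
  obtain ⟨j, hju, hjv⟩ := Finset.exists_of_ssubset hv
  have h_disj : (coords d v : Set (Fin s × Fin d)) ⊆ (↑(coords d {j}))ᶜ := fun p hp hpj =>
    hjv (Finset.mem_singleton.1 (mem_coords.1 hpj) ▸ mem_coords.1 hp)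
  exact setIntegral_mul_psi_eq_zero S u κ τ γ h_vol (by omega) hju
    (fun _ _ h => dependsOn_anova f v fun p hp => h p (h_disj hp))

theorem setIntegral_mul_psi_eq_setIntegral_anova_mul_psi (hb : 2 ≤ b)
    (h_vol : ∀ j, volume (X j) = 1) {f : Pt s d → ℝ} (hf : IntegrableOn f (prodSet X)) :
    ∫ x in prodSet X, f x * psi S u κ τ γ x =
      ∫ x in prodSet X, anova X f u x * psi S u κ τ γ x := by
  have hX j := (S j).measurableSet
  have h_comp (v) : IntegrableOn (fun x => anova X f v x * psi S u κ τ γ x) (prodSet X) :=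
    integrableOn_mul_psi S u κ τ γ (integrableOn_anova hX h_vol hf v)
  have h_sum : ∫ x in prodSet X, ∑ v ∈ u.ssubsets, anova X f v x * psi S u κ τ γ x = 0 := by
    rw [integral_finsetSum _ fun v _ => h_comp v]
    exact Finset.sum_eq_zero fun v hv =>
      setIntegral_anova_mul_psi_of_ssubset S u κ τ γ hb h_vol f (Finset.mem_ssubsets.1 hv)
  have h_sub : IntegrableOn (fun x => f x - ∑ v ∈ u.ssubsets, anova X f v x) (prodSet X) :=
    hf.sub (integrable_finsetSum _ fun v _ => integrableOn_anova hX h_vol hf v)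
  calc ∫ x in prodSet X, f x * psi S u κ τ γ x
      = ∫ x in prodSet X, (f x - ∑ v ∈ u.ssubsets, anova X f v x) * psi S u κ τ γ x := by
        simp only [sub_mul, Finset.sum_mul]
        rw [integral_sub (integrableOn_mul_psi S u κ τ γ hf)
          (integrable_finsetSum _ fun v _ => h_comp v), h_sum, sub_zero]
    _ = ∫ x in prodSet X, anova X f u x * psi S u κ τ γ x := by
        rw [← setIntegral_blockIntegral (u := u) hX h_vol
          (integrableOn_mul_psi S u κ τ γ h_sub), anova_eq_blockIntegral f u]
        simp only [blockIntegral_mul_of_dependsOn (dependsOn_psi S u κ τ γ)]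

end AnovaCoefficients

section PderivWithin

variable {ι : Type*} [DecidableEq ι] {R : Set (ι → ℝ)} {g g' : (ι → ℝ) → ℝ}

/-- The partial derivative in the coordinate `p` within `R`. It is continuous up to the boundary
of `R`, unlike `pderiv`, whose value there depends on the function outside `R`. -/
def pderivWithin (R : Set (ι → ℝ)) (p : ι) (g : (ι → ℝ) → ℝ) : (ι → ℝ) → ℝ :=
  fun x => fderivWithin ℝ g R x (Pi.single p 1)

theorem pderivWithin_congr (h : EqOn g g' R) (p : ι) :
    EqOn (pderivWithin R p g) (pderivWithin R p g') R := fun x hx => by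
  rw [pderivWithin, pderivWithin, fderivWithin_congr h (h hx)]

theorem hasPartialWithin_pderivWithin [Finite ι] {x : ι → ℝ}
    (hg : DifferentiableWithinAt ℝ g R x) (p : ι) :
    HasPartialWithin R p g (pderivWithin R p g x) x := by
  cases nonempty_fintype ι
  have h_fderiv : HasFDerivWithinAt g (fderivWithin ℝ g R x) R (Function.update x p (x p)) := by
    rw [Function.update_eq_self]
    exact hg.hasFDerivWithinAt
  exact h_fderiv.comp_hasDerivWithinAt (x p) (hasDerivAt_update x p (x p)).hasDerivWithinAt
    fun _ ht => ht

variable [Fintype ι]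

theorem contDiffOn_pderivWithin (hR : UniqueDiffOn ℝ R) {m : ℕ}
    (hg : ContDiffOn ℝ ((m + 1 : ℕ) : WithTop ℕ∞) g R) (p : ι) :
    ContDiffOn ℝ (m : WithTop ℕ∞) (pderivWithin R p g) R :=
  (hg.fderivWithin hR (by norm_cast)).clm_apply contDiffOn_const

theorem pderivWithin_comm (hR : UniqueDiffOn ℝ R) (h_closure : R ⊆ closure (interior R))
    (hg : ContDiffOn ℝ 2 g R) (p q : ι) :
    EqOn (pderivWithin R p (pderivWithin R q g)) (pderivWithin R q (pderivWithin R p g)) R := by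
  intro x hx
  have h_diff : DifferentiableWithinAt ℝ (fderivWithin ℝ g R) R x :=
    (hg.fderivWithin hR (m := 1) (by norm_num)).differentiableOn (by norm_num) x hx
  have h_second (p q) : pderivWithin R p (pderivWithin R q g) x =
      fderivWithin ℝ (fderivWithin ℝ g R) R x (Pi.single p 1) (Pi.single q 1) := by
    unfold pderivWithin
    rw [fderivWithin_clm_apply (hR x hx) h_diff (differentiableWithinAt_const _)]
    simp
  rw [h_second, h_second]
  exact ((hg x hx).isSymmSndFDerivWithinAt (by simp) hR (h_closure hx) hx).eq _ _

theorem contDiffOn_foldr_pderivWithin (hR : UniqueDiffOn ℝ R) (l : List ι) {m n : ℕ}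
    (hg : ContDiffOn ℝ (n : WithTop ℕ∞) g R) (hn : m + l.length ≤ n) :
    ContDiffOn ℝ (m : WithTop ℕ∞) (l.foldr (pderivWithin R) g) R := by
  induction l generalizing m with
  | nil => exact hg.of_le (by exact_mod_cast hn)
  | cons p l ih =>
    rw [List.length_cons] at hn
    exact contDiffOn_pderivWithin hR (ih (by omega)) p

theorem foldr_pderivWithin_perm (hR : UniqueDiffOn ℝ R) (h_closure : R ⊆ closure (interior R))
    {n : ℕ} (hg : ContDiffOn ℝ (n : WithTop ℕ∞) g R) {l l' : List ι} (h : l.Perm l')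
    (hn : l.length ≤ n) :
    EqOn (l.foldr (pderivWithin R) g) (l'.foldr (pderivWithin R) g) R := by
  induction h with
  | nil => exact eqOn_refl _ _
  | cons p _ ih =>
    rw [List.length_cons] at hn
    exact pderivWithin_congr (ih (by omega)) p
  | swap p q l =>
    simp only [List.length_cons] at hn
    exact pderivWithin_comm hR h_closure
      (contDiffOn_foldr_pderivWithin hR l (m := 2) hg (by omega)) q p
  | trans h₁ _ ih₁ ih₂ => exact (ih₁ hn).trans (ih₂ (h₁.length_eq ▸ hn))

theorem hasMixedPartialsOn_foldr_pderivWithin (hR : UniqueDiffOn ℝ R)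
    (h_closure : R ⊆ closure (interior R))
    (hg : ContDiffOn ℝ (Fintype.card ι : WithTop ℕ∞) g R) :
    HasMixedPartialsOn R g fun v => v.toList.foldr (pderivWithin R) g where
  eqOn := by
    rw [Finset.toList_empty]
    exact eqOn_refl _ _
  continuousOn v := by
    have h_card : 0 + v.toList.length ≤ Fintype.card ι := by simpa using v.card_le_univ
    exact (contDiffOn_foldr_pderivWithin hR v.toList hg h_card).continuousOn
  hasPartialWithin v p hp x hx := by
    have h_card : 1 + v.toList.length ≤ Fintype.card ι := by
      rw [Finset.length_toList, add_comm, ← Finset.card_insert_of_notMem hp]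
      exact Finset.card_le_univ _
    have h_perm := Finset.toList_insert hp
    have h_length : (insert p v).toList.length ≤ Fintype.card ι := by
      rw [Finset.length_toList]
      exact Finset.card_le_univ _
    rw [foldr_pderivWithin_perm hR h_closure hg h_perm h_length hx, List.foldr_cons]
    exact hasPartialWithin_pderivWithin ((contDiffOn_foldr_pderivWithin hR v.toList hg
      h_card).differentiableOn (by norm_num) x hx) p

end PderivWithin

section CmExtension

variable {s d b : ℕ} {X : Fin s → Set (EuclideanSpace ℝ (Fin d))}

theorem interior_nonempty_of_convex {ι : Type*} [Fintype ι] {R : Set (ι → ℝ)} (hR : Convex ℝ R)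
    (h_vol : volume R ≠ 0) : (interior R).Nonempty := by
  rw [nonempty_iff_ne_empty]
  refine fun h_empty => h_vol (measure_mono_null subset_closure ?_)
  simpa only [frontier, h_empty, sdiff_empty] using hR.addHaar_frontier volume

variable (S : ∀ j, RecursiveSplit b (X j)) (u : Finset (Fin s)) (κ : u → ℕ)

theorem ofReal_sigmaSq_le_of_isCmExtension (hd : 1 ≤ d) (hb : 2 ≤ b)
    (hX : ∀ j, Bornology.IsBounded (X j)) (h_vol : ∀ j, volume (X j) = 1) {C : ℝ} (hC : 1 ≤ C)
    (h_diam : ∀ j k (t : Fin k → Fin b),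
      Metric.diam ((S j).cell k t) ≤ C * (b : ℝ) ^ (-(k : ℝ) / (d : ℝ)))
    {f F : Pt s d → ℝ} (hf : IntegrableOn f (prodSet X))
    (hF : IsCmExtension (s * d) (prodSet X) (anova X f u) F) :
    ENNReal.ofReal (sigmaSq S f u κ) ≤
      ENNReal.ofReal ((((2 ^ d - 1) * C ^ d * (2 - 2 / (b : ℝ))) ^ 2) ^ u.card *
        (b : ℝ) ^ (-2 * ((∑ j, κ j : ℕ) : ℝ) / (d : ℝ))) * hNorm S u κ F ^ 2 := by
  have h_meas := measurableSet_prodSet fun j => (S j).measurableSet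
  have h_prod := volume_prodSet_eq_one (fun j => (S j).measurableSet) h_vol
  have h_sub := subset_rectHull (isBounded_prodSet hX)
  set R := rectHull (prodSet X)
  have h_convex : Convex ℝ R := convex_Icc _ _
  have h_int : (interior R).Nonempty := interior_nonempty_of_convex h_convex fun h => by
    simp [measure_mono_null h_sub h] at h_prod
  have h_closure : R ⊆ closure (interior R) := by
    rw [h_convex.closure_interior_eq_closure_of_nonempty_interior h_int]
    exact subset_closure
  have h_partials := hasMixedPartialsOn_foldr_pderivWithin
    (uniqueDiffOn_convex h_convex h_int) h_closure (by simpa using hF.1)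
  have h_eq := (h_partials.indicator.eqOn.mono h_sub).trans hF.2
  have h_anova := integrableOn_anova (fun j => (S j).measurableSet) h_vol hf u
  refine ofReal_sigmaSq_le_of_isIntegralFamily S u κ hd hb hX h_vol hC h_diam
    (h_partials.isIntegralFamily_indicator isCompact_Icc)
    ((integrableOn_congr_fun h_eq h_meas).2 h_anova) (fun τ γ => ?_) fun T => ?_
  · rw [setIntegral_mul_psi_eq_setIntegral_anova_mul_psi S u κ τ γ hb h_vol hf]
    exact setIntegral_congr_fun h_meas fun x hx => by simp only [h_eq hx]
  · have h_frontier : ∀ᵐ x, x ∉ frontier R :=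
      measure_eq_zero_iff_ae_notMem.1 (h_convex.addHaar_frontier volume)
    filter_upwards [h_frontier] with x hx hxR
    have hx_int : x ∈ interior R := by
      by_contra h
      exact hx ⟨subset_closure hxR, h⟩
    exact h_partials.indicator.mixedPartial_eqOn interior_subset
      (fun _ hz p _ => eventually_update_mem isOpen_interior hz p) hx_int

end CmExtension

section Frontier

variable {ι : Type*} {B : Set (ι → ℝ)} {c : ι → ℝ}

theorem volume_frontier_inter_orthant_eq_zero [Fintype ι]
    (hB : ∀ x ∈ B, {y : ι → ℝ | ∀ p, y p ∈ uIcc (c p) (x p)} ⊆ B) :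
    volume (frontier B ∩ {x | ∀ p, c p < x p}) = 0 := by
  have h_open : IsOpen {x : ι → ℝ | ∀ p, c p < x p} := by
    simp only [ofPred_forall]
    exact isOpen_iInter_of_finite fun p => isOpen_lt continuous_const (continuous_apply p)
  have h_ord : OrdConnected (B ∩ {x | ∀ p, c p < x p}) :=
    ⟨fun x hx y hy z hz => ⟨hB y hy.1 fun p => Icc_subset_uIcc
      ⟨(hx.2 p).le.trans (hz.1 p), hz.2 p⟩, fun p => (hx.2 p).trans_le (hz.1 p)⟩⟩
  rw [← frontier_inter_open_inter h_open]
  exact measure_mono_null inter_subset_left h_ord.null_frontier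

open Classical in
/-- The reflection at `c` in the coordinates outside `T`. It reduces statements about an orthant
with corner `c` to the positive one. -/
def coordReflection (c : ι → ℝ) (T : Set ι) : (ι → ℝ) ≃ₜ (ι → ℝ) :=
  Homeomorph.piCongrRight fun p =>
    if p ∈ T then Homeomorph.refl ℝ else Homeomorph.subLeft (c p + c p)

theorem coordReflection_of_mem {T : Set ι} {p : ι} (hp : p ∈ T) (c x : ι → ℝ) :
    coordReflection c T x p = x p := by
  simp [coordReflection, hp]

theorem coordReflection_of_notMem {T : Set ι} {p : ι} (hp : p ∉ T) (c x : ι → ℝ) :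
    coordReflection c T x p = c p + c p - x p := by
  simp [coordReflection, hp]

theorem coordReflection_coordReflection (c : ι → ℝ) (T : Set ι) (x : ι → ℝ) :
    coordReflection c T (coordReflection c T x) = x := by
  ext p
  by_cases hp : p ∈ T
  · simp only [coordReflection_of_mem hp]
  · simp only [coordReflection_of_notMem hp, sub_sub_cancel]

theorem coordReflection_apply_mem_uIcc_iff {T : Set ι} {p : ι} {x y : ι → ℝ} :
    coordReflection c T y p ∈ uIcc (c p) (coordReflection c T x p) ↔ y p ∈ uIcc (c p) (x p) := by
  by_cases hp : p ∈ T
  · simp only [coordReflection_of_mem hp]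
  · simp only [coordReflection_of_notMem hp, mem_uIcc]
    constructor <;> rintro (h | h) <;> [right; left; right; left] <;> constructor <;> linarith

variable [Fintype ι]

theorem measurePreserving_coordReflection (c : ι → ℝ) (T : Set ι) :
    MeasurePreserving (coordReflection c T) volume volume := by
  classical
  refine volume_preserving_pi (f := fun p => ⇑(if p ∈ T then Homeomorph.refl ℝ else
    Homeomorph.subLeft (c p + c p))) fun p => ?_
  split_ifs
  · exact MeasurePreserving.id volume
  · exact Measure.measurePreserving_sub_left volume (c p + c p)

theorem volume_frontier_eq_zero
    (hB : ∀ x ∈ B, {y : ι → ℝ | ∀ p, y p ∈ uIcc (c p) (x p)} ⊆ B) : volume (frontier B) = 0 := by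
  have h_orthant : ∀ᵐ x : ι → ℝ, ∀ T, coordReflection c T x ∉
      frontier (coordReflection c T ⁻¹' B) ∩ {x | ∀ p, c p < x p} := by
    refine ae_all_iff.2 fun T =>
      (measurePreserving_coordReflection c T).quasiMeasurePreserving.ae
        (measure_eq_zero_iff_ae_notMem.1 (volume_frontier_inter_orthant_eq_zero ?_))
    exact fun x hx y hy => hB _ hx fun p => coordReflection_apply_mem_uIcc_iff.2 (hy p)
  have h_ne : ∀ᵐ x : ι → ℝ, ∀ p, x p ≠ c p := ae_all_iff.2 fun p =>
    (Measure.quasiMeasurePreserving_eval (fun _ : ι => (volume : Measure ℝ)) p).ae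
      (measure_eq_zero_iff_ae_notMem.1 (measure_singleton (c p)))
  rw [measure_eq_zero_iff_ae_notMem]
  filter_upwards [h_orthant, h_ne] with x hx hxc hxB
  refine hx {p | c p < x p} ⟨?_, fun p => ?_⟩
  · rwa [← Homeomorph.preimage_frontier, mem_preimage, coordReflection_coordReflection]
  · by_cases hp : p ∈ {p | c p < x p}
    · rwa [coordReflection_of_mem hp]
    · rw [coordReflection_of_notMem hp]
      linarith [lt_of_le_of_ne (not_lt.1 hp) (hxc p)]

end Frontier

section PartialIntegral

variable {ι : Type*} [DecidableEq ι] {Ψ : (ι → ℝ) → ℝ} {K : ℝ} {w T : Finset ι} {p : ι}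
  (c : ι → ℝ)

/-- The mixed partial derivative in the coordinates of `T` of the signed integral of `Ψ` in the
coordinates of `w` from `c` to `x`, for a function `Ψ` of the coordinates of `w` alone. -/
def partialIntegral (w T : Finset ι) (c : ι → ℝ) (Ψ : (ι → ℝ) → ℝ) (x : ι → ℝ) : ℝ :=
  if T ⊆ w then signedIntegral (w \ T) c x Ψ x else 0

theorem signedIntegral_update_endpoint {v : Finset ι} (hp : p ∉ v) (x : ι → ℝ) (t : ℝ)
    (z : ι → ℝ) : signedIntegral v c (Function.update x p t) Ψ z = signedIntegral v c x Ψ z :=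
  signedIntegral_congr (fun _ hq => Function.update_of_ne (ne_of_mem_of_not_mem hq hp) _ _)
    fun _ _ => rfl

theorem signedIntegral_update_base {v : Finset ι} (hp : p ∈ v) (x : ι → ℝ) (t : ℝ) (z : ι → ℝ) :
    signedIntegral v c x Ψ (Function.update z p t) = signedIntegral v c x Ψ z :=
  signedIntegral_congr (fun _ _ => rfl) fun y _ => by rw [hybrid_update_of_mem hp]

theorem partialIntegral_insert_update (hTw : T ⊆ w) (hpw : p ∈ w) (x : ι → ℝ) (t : ℝ) :
    partialIntegral w (insert p T) c Ψ (Function.update x p t) =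
      signedIntegral (w \ insert p T) c x Ψ (Function.update x p t) := by
  rw [partialIntegral, if_pos (Finset.insert_subset hpw hTw), signedIntegral_update_endpoint]
  simp

theorem partialIntegral_of_not_subset (hTw : ¬ T ⊆ w) (x : ι → ℝ) :
    partialIntegral w T c Ψ x = 0 := if_neg hTw

theorem partialIntegral_insert_of_notMem (hpw : p ∉ w) (x : ι → ℝ) :
    partialIntegral w (insert p T) c Ψ x = 0 :=
  partialIntegral_of_not_subset c (fun h => hpw (h (Finset.mem_insert_self p T))) x

theorem partialIntegral_update_of_notMem (hpw : p ∉ w)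
    (h_cyl : ∀ x t, Ψ (Function.update x p t) = Ψ x) (x : ι → ℝ) (t : ℝ) :
    partialIntegral w T c Ψ (Function.update x p t) = partialIntegral w T c Ψ x := by
  have hp : p ∉ w \ T := fun h => hpw (Finset.mem_sdiff.1 h).1
  unfold partialIntegral
  rw [signedIntegral_update_endpoint c hp]
  congr 1
  exact signedIntegral_congr (fun _ _ => rfl) fun y _ => by
    rw [hybrid_update_of_notMem hp, h_cyl]

theorem partialIntegral_update_eq_integral (hΨ : Measurable Ψ) (hK : ∀ x, |Ψ x| ≤ K) (hTw : T ⊆ w)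
    (hpw : p ∈ w) (hpT : p ∉ T) (x : ι → ℝ) (r : ℝ) :
    partialIntegral w T c Ψ (Function.update x p r) =
      ∫ t in (c p)..r, partialIntegral w (insert p T) c Ψ (Function.update x p t) := by
  have h_sdiff : w \ T = insert p (w \ insert p T) := by
    rw [Finset.sdiff_insert, Finset.insert_erase (by simp [hpw, hpT])]
  simp_rw [partialIntegral_insert_update c hTw hpw]
  rw [partialIntegral, if_pos hTw, signedIntegral_update_base c (by simp [hpw, hpT]), h_sdiff,
    signedIntegral_insert (by simp) c _ x hΨ hK, Function.update_self]
  exact intervalIntegral.integral_congr fun t _ => signedIntegral_update_endpoint c (by simp) x r _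

theorem measurable_partialIntegral (hΨ : Measurable Ψ) : Measurable (partialIntegral w T c Ψ) := by
  unfold partialIntegral
  split_ifs
  · exact measurable_signedIntegral _ c hΨ measurable_id measurable_id
  · exact measurable_const

theorem abs_partialIntegral_le (hK : ∀ x, |Ψ x| ≤ K) (x : ι → ℝ) :
    |partialIntegral w T c Ψ x| ≤ K * ∏ p ∈ w \ T, |x p - c p| := by
  unfold partialIntegral
  split_ifs
  · exact abs_signedIntegral_le (Filter.Eventually.of_forall fun y _ => hK _)
  · rw [abs_zero]
    exact mul_nonneg ((abs_nonneg _).trans (hK x)) (Finset.prod_nonneg fun _ _ => abs_nonneg _)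

theorem intervalIntegrable_partialIntegral (hΨ : Measurable Ψ) (hK : ∀ x, |Ψ x| ≤ K)
    (x : ι → ℝ) (a b : ℝ) :
    IntervalIntegrable (fun t => partialIntegral w (insert p T) c Ψ (Function.update x p t))
      volume a b := by
  by_cases h : insert p T ⊆ w
  · rw [Finset.insert_subset_iff] at h
    simp_rw [partialIntegral_insert_update c h.2 h.1]
    exact intervalIntegrable_signedIntegral _ c x x p hΨ hK a b
  · simp only [partialIntegral_of_not_subset c h]
    exact intervalIntegrable_const

theorem partialIntegral_sub_update (hΨ : Measurable Ψ) (hK : ∀ x, |Ψ x| ≤ K)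
    (h_cyl : ∀ q ∉ w, ∀ x t, Ψ (Function.update x q t) = Ψ x) (hpT : p ∉ T) (x : ι → ℝ) (r : ℝ) :
    partialIntegral w T c Ψ x - partialIntegral w T c Ψ (Function.update x p r) =
      ∫ t in r..(x p), partialIntegral w (insert p T) c Ψ (Function.update x p t) := by
  by_cases hTw : T ⊆ w
  · by_cases hpw : p ∈ w
    · have h_self := partialIntegral_update_eq_integral c hΨ hK hTw hpw hpT x (x p)
      rw [Function.update_eq_self] at h_self
      rw [h_self, partialIntegral_update_eq_integral c hΨ hK hTw hpw hpT,
        intervalIntegral.integral_interval_sub_left] <;>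
      exact intervalIntegrable_partialIntegral c hΨ hK _ _ _
    · simp only [partialIntegral_update_of_notMem c hpw (h_cyl p hpw), sub_self,
        partialIntegral_insert_of_notMem c hpw, intervalIntegral.integral_zero]
  · have h_insert : ¬ insert p T ⊆ w := mt (Finset.subset_insert p T).trans hTw
    simp only [partialIntegral_of_not_subset c h_insert, partialIntegral_of_not_subset c hTw,
      sub_self, intervalIntegral.integral_zero]

theorem continuousAt_signedIntegral_update {v : Finset ι} (hΨ : Measurable Ψ)
    (hK : ∀ x, |Ψ x| ≤ K) {x : ι → ℝ} (hx : ∀ᵐ y : v → ℝ, ContinuousAt Ψ (hybrid v x y)) :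
    ContinuousAt (fun t => signedIntegral v c x Ψ (Function.update x p t)) (x p) := by
  refine ContinuousAt.mul continuousAt_const (continuousAt_of_dominated (bound := fun _ => K)
    (Filter.Eventually.of_forall fun t =>
      (hΨ.comp (measurable_hybrid_right _ _)).aestronglyMeasurable)
    (Filter.Eventually.of_forall fun t => Filter.Eventually.of_forall fun y => hK _)
    (integrableOn_const (by rw [volume_spanBox]; exact ENNReal.ofReal_ne_top))
    (ae_restrict_of_ae ?_))
  filter_upwards [hx] with y hy
  have h_line : Continuous fun t => hybrid v (Function.update x p t) y :=
    (continuous_hybrid v).comp ((continuous_const.update p continuous_id).prodMk continuous_const)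
  refine ContinuousAt.comp (g := Ψ) ?_ h_line.continuousAt
  rwa [Function.update_eq_self]

theorem hasDerivAt_partialIntegral (hΨ : Measurable Ψ) (hK : ∀ x, |Ψ x| ≤ K)
    (h_cyl : ∀ q ∉ w, ∀ x t, Ψ (Function.update x q t) = Ψ x) (hpT : p ∉ T) {x : ι → ℝ}
    (hx : ∀ᵐ y : ↥(w \ insert p T) → ℝ, ContinuousAt Ψ (hybrid (w \ insert p T) x y)) :
    HasDerivAt (fun t => partialIntegral w T c Ψ (Function.update x p t))
      (partialIntegral w (insert p T) c Ψ x) (x p) := by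
  by_cases hTw : T ⊆ w
  · by_cases hpw : p ∈ w
    · have h_cont : ContinuousAt
          (fun t => partialIntegral w (insert p T) c Ψ (Function.update x p t)) (x p) := by
        simp_rw [partialIntegral_insert_update c hTw hpw]
        exact continuousAt_signedIntegral_update c hΨ hK hx
      have h_meas : Measurable
          fun t => partialIntegral w (insert p T) c Ψ (Function.update x p t) :=
        (measurable_partialIntegral c hΨ).comp (measurable_update x)
      have h_deriv := intervalIntegral.integral_hasDerivAt_right
        (intervalIntegrable_partialIntegral c hΨ hK x (c p) (x p))
        h_meas.stronglyMeasurable.stronglyMeasurableAtFilter h_cont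
      rw [Function.update_eq_self] at h_deriv
      simpa only [partialIntegral_update_eq_integral c hΨ hK hTw hpw hpT] using h_deriv
    · simp only [partialIntegral_update_of_notMem c hpw (h_cyl p hpw),
        partialIntegral_insert_of_notMem c hpw]
      exact hasDerivAt_const _ _
  · have h_insert : ¬ insert p T ⊆ w := mt (Finset.subset_insert p T).trans hTw
    simp only [partialIntegral_of_not_subset c h_insert, partialIntegral_of_not_subset c hTw]
    exact hasDerivAt_const _ _

end PartialIntegral

section SliceCylinder

variable {ι : Type*} [DecidableEq ι]

/-- The cylinder over the slice of `A` through `c` in the coordinates of `w`. Its frontier carries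
the discontinuities of the integrand of index `w` in the Sobol' extension. -/
def sliceCylinder (A : Set (ι → ℝ)) (c : ι → ℝ) (w : Finset ι) : Set (ι → ℝ) :=
  {x | w.piecewise x c ∈ A}

theorem continuous_piecewise_left (w : Finset ι) (c : ι → ℝ) :
    Continuous fun x : ι → ℝ => w.piecewise x c := by
  refine continuous_pi fun p => ?_
  by_cases hp : p ∈ w
  · simp only [hp, Finset.piecewise_eq_of_mem]
    exact continuous_apply p
  · simp only [hp, not_false_eq_true, Finset.piecewise_eq_of_notMem]
    exact continuous_const

theorem piecewise_hybrid (w : Finset ι) (c x : ι → ℝ) (y : w → ℝ) :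
    w.piecewise (hybrid w x y) c = hybrid w c y := by
  ext p; by_cases hp : p ∈ w <;> simp [hp, hybrid]

theorem piecewise_update_of_notMem {w : Finset ι} {p : ι} (hp : p ∉ w) (c x : ι → ℝ) (t : ℝ) :
    w.piecewise (Function.update x p t) c = w.piecewise x c :=
  Finset.piecewise_congr w (fun _ hq => Function.update_of_ne (ne_of_mem_of_not_mem hq hp) _ _)
    fun _ _ => rfl

variable {A : Set (ι → ℝ)} {c : ι → ℝ} {w : Finset ι}

theorem mem_frontier_sliceCylinder_congr {x x' : ι → ℝ} (h : ∀ p ∈ w, x p = x' p) :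
    x ∈ frontier (sliceCylinder A c w) ↔ x' ∈ frontier (sliceCylinder A c w) := by
  have h_preimage : Homeomorph.addRight (x' - x) ⁻¹' sliceCylinder A c w =
      sliceCylinder A c w := by
    ext z
    have h_eq : w.piecewise (z + (x' - x)) c = w.piecewise z c :=
      Finset.piecewise_congr w (fun p hp => by simp [h p hp]) fun _ _ => rfl
    exact iff_of_eq (congrArg (· ∈ A) h_eq)
  have h_frontier := (Homeomorph.addRight (x' - x)).preimage_frontier (sliceCylinder A c w)
  rw [h_preimage] at h_frontier
  nth_rw 1 [← h_frontier]
  simp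

theorem continuousAt_indicator_comp_piecewise {g : (ι → ℝ) → ℝ} (hg : ContinuousOn g A)
    {x : ι → ℝ} (hx : x ∉ frontier (sliceCylinder A c w)) :
    ContinuousAt (fun z => A.indicator g (w.piecewise z c)) x := by
  have h_on : ContinuousOn (fun z => g (w.piecewise z c)) (sliceCylinder A c w) :=
    hg.comp (continuous_piecewise_left w c).continuousOn fun _ hz => hz
  exact (h_on.mono interior_subset).continuousAt_indicator hx

theorem IsSobolExtensible.ordConnected_update (hA : IsSobolExtensible A c) (x : ι → ℝ) (p : ι) :
    OrdConnected {t | Function.update x p t ∈ A} := by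
  refine ordConnected_of_uIcc_subset_left (x := c p) fun t ht r hr => hA.2.2.2 _ ht fun q => ?_
  obtain rfl | hq := eq_or_ne q p
  · simpa using hr
  · simp [hq]

theorem volume_frontier_sliceCylinder [Fintype ι]
    (hA : ∀ z ∈ A, {y : ι → ℝ | ∀ p, y p ∈ uIcc (c p) (z p)} ⊆ A) (w : Finset ι) :
    volume (frontier (sliceCylinder A c w)) = 0 := by
  refine volume_frontier_eq_zero (c := c) fun x hx y hy => hA _ hx fun p => ?_
  by_cases hp : p ∈ w
  · simpa [hp] using hy p
  · simp [hp]

theorem ae_hybrid_notMem_frontier_sliceCylinder [Finite ι]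
    (hA : ∀ z ∈ A, {y : ι → ℝ | ∀ p, y p ∈ uIcc (c p) (z p)} ⊆ A) (w : Finset ι) :
    ∀ᵐ y : w → ℝ, hybrid w c y ∉ frontier (sliceCylinder A c w) := by
  cases nonempty_fintype ι
  obtain ⟨x, hx⟩ := (ae_ae_hybrid
    (measure_eq_zero_iff_ae_notMem.1 (volume_frontier_sliceCylinder hA w)) w).exists
  filter_upwards [hx] with y hy
  rwa [mem_frontier_sliceCylinder_congr (x' := hybrid w x y) fun p hp => by
    rw [hybrid_of_mem hp, hybrid_of_mem hp]]

end SliceCylinder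

section SobolExtension

variable {s d : ℕ} {A : Set (Pt s d)} {c : Pt s d} {g : Pt s d → ℝ}
  {D : Finset (Fin s × Fin d) → Pt s d → ℝ}

theorem HasMixedPartialsOn.mixedPartial_eq_of_mem_interior_sliceCylinder
    (h : HasMixedPartialsOn A g D) {w : Finset (Fin s × Fin d)} {x : Pt s d}
    (hx : ∀ p ∉ w, x p = c p) (hx_int : x ∈ interior (sliceCylinder A c w)) :
    mixedPartial w g x = D w x := by
  refine h.mixedPartial_eqOn (O := {z | (∀ p ∉ w, z p = c p) ∧ z ∈ interior (sliceCylinder A c w)})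
    (fun z hz => ?_) (fun z hz p hp => ?_) ⟨hx, hx_int⟩
  · have h_piecewise : w.piecewise z c = z := by
      ext p; by_cases hp : p ∈ w <;> simp [hp, hz.1]
    have hz_mem : z ∈ sliceCylinder A c w := interior_subset hz.2
    rwa [sliceCylinder, mem_ofPred_eq, h_piecewise] at hz_mem
  · filter_upwards [eventually_update_mem isOpen_interior hz.2 p] with t ht
    refine ⟨fun q hq => ?_, ht⟩
    rw [Function.update_of_ne (ne_of_mem_of_not_mem hp hq).symm, hz.1 q hq]

theorem HasMixedPartialsOn.indicator_mixedPartial_ae_eq (h : HasMixedPartialsOn A g D)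
    (hA : ∀ z ∈ A, {y : Pt s d | ∀ p, y p ∈ uIcc (c p) (z p)} ⊆ A) (w : Finset (Fin s × Fin d)) :
    ∀ᵐ y : w → ℝ, A.indicator (mixedPartial w g) (hybrid w c y) =
      A.indicator (D w) (hybrid w c y) := by
  filter_upwards [ae_hybrid_notMem_frontier_sliceCylinder hA w] with y hy
  by_cases hyA : hybrid w c y ∈ A
  · have hy_mem : hybrid w c y ∈ sliceCylinder A c w := by
      rwa [sliceCylinder, mem_ofPred_eq, piecewise_hybrid]
    rw [indicator_of_mem hyA, indicator_of_mem hyA]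
    refine h.mixedPartial_eq_of_mem_interior_sliceCylinder
      (fun p hp => hybrid_of_notMem hp c y) ?_
    by_contra hy_int
    exact hy ⟨subset_closure hy_mem, hy_int⟩
  · rw [indicator_of_notMem hyA, indicator_of_notMem hyA]

variable {ι : Type*} [DecidableEq ι]

/-- At `x`, the integrands of the Sobol' extension are a.e. continuous on the slices through `x` in
the coordinates outside `T`; almost every `x` has this property, and at such points the extension
can be differentiated in `T` under the integral sign. -/
def IsRegularPoint (A : Set (ι → ℝ)) (c : ι → ℝ) (T : Finset ι) (x : ι → ℝ) : Prop :=
  ∀ w : Finset ι, ∀ᵐ y : ↥(w \ T) → ℝ, hybrid (w \ T) x y ∉ frontier (sliceCylinder A c w)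

theorem IsRegularPoint.update {A : Set (ι → ℝ)} {c : ι → ℝ} {T : Finset ι} {x : ι → ℝ}
    (h : IsRegularPoint A c T x) {p : ι} (hp : p ∉ T) (t : ℝ) :
    IsRegularPoint A c T (Function.update x p t) := by
  intro w
  filter_upwards [h w] with y hy
  by_cases hpw : p ∈ w
  · rwa [hybrid_update_of_mem (by simp [hp, hpw])]
  · rwa [hybrid_update_of_notMem (by simp [hpw]),
      mem_frontier_sliceCylinder_congr (x' := hybrid (w \ T) x y) fun q hq =>
        Function.update_of_ne (ne_of_mem_of_not_mem hq hpw) _ _]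

variable [Fintype ι]

theorem ae_isRegularPoint {A : Set (ι → ℝ)} {c : ι → ℝ}
    (hA : ∀ z ∈ A, {y : ι → ℝ | ∀ p, y p ∈ uIcc (c p) (z p)} ⊆ A) :
    ∀ᵐ x, ∀ T, IsRegularPoint A c T x :=
  ae_all_iff.2 fun T => ae_all_iff.2 fun w =>
    ae_ae_hybrid (measure_eq_zero_iff_ae_notMem.1 (volume_frontier_sliceCylinder hA w)) (w \ T)

/-- The mixed partial derivative in the coordinates of `T` of the Sobol' extension with anchor `c`,
where `G w` is the mixed partial derivative in `w` of the extended function, continued by zero. -/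
def sobolPartial (c : ι → ℝ) (G : Finset ι → (ι → ℝ) → ℝ) (T : Finset ι) (x : ι → ℝ) : ℝ :=
  ∑ w, partialIntegral w T c (fun z => G w (w.piecewise z c)) x

theorem sobolPartial_empty (c : ι → ℝ) (G : Finset ι → (ι → ℝ) → ℝ) (x : ι → ℝ) :
    sobolPartial c G ∅ x = ∑ w, signedIntegral w c x (fun z => G w (w.piecewise z c)) x := by
  simp only [sobolPartial, partialIntegral, Finset.empty_subset, if_true, Finset.sdiff_empty]

theorem HasMixedPartialsOn.sobolExtension_eq_sobolPartial (h : HasMixedPartialsOn A g D)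
    (hA : ∀ z ∈ A, {y : Pt s d | ∀ p, y p ∈ uIcc (c p) (z p)} ⊆ A) :
    sobolExtension A c g = sobolPartial c (fun w => A.indicator (D w)) ∅ := by
  ext x
  rw [sobolPartial_empty, sobolExtension]
  refine Finset.sum_congr rfl fun w _ => ?_
  have h_integral : ∫ y in (univ.pi fun p : w => uIcc (c p) (x p) : Set (w → ℝ)),
        A.indicator (mixedPartial w g) (hybrid w c y) =
      ∫ y in (univ.pi fun p : w => uIcc (c p) (x p) : Set (w → ℝ)),
        A.indicator (D w) (w.piecewise (hybrid w x y) c) := by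
    refine integral_congr_ae (ae_restrict_of_ae ?_)
    filter_upwards [h.indicator_mixedPartial_ae_eq hA w] with y hy
    rw [hy, piecewise_hybrid]
  rw [signedIntegral, h_integral]

section Partials

variable {G : Finset ι → (ι → ℝ) → ℝ} {K : ℝ} (c : ι → ℝ)

theorem measurable_sobolPartial (hG : ∀ w, Measurable (G w)) (T : Finset ι) :
    Measurable (sobolPartial c G T) :=
  Finset.measurable_sum _ fun w _ =>
    measurable_partialIntegral c ((hG w).comp (continuous_piecewise_left w c).measurable)

theorem exists_bound_sobolPartial (hK : ∀ w x, |G w x| ≤ K) {R : Set (ι → ℝ)} (hR : IsCompact R) :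
    ∃ L, ∀ T, ∀ x ∈ R, |sobolPartial c G T x| ≤ L := by
  have h_bound T x : |sobolPartial c G T x| ≤ ∑ w, K * ∏ p ∈ w \ T, |x p - c p| :=
    (Finset.abs_sum_le_sum_abs _ _).trans
      (Finset.sum_le_sum fun w _ => abs_partialIntegral_le c (fun _ => hK w _) x)
  have h_cont T : Continuous fun x : ι → ℝ => ∑ w, K * ∏ p ∈ w \ T, |x p - c p| := by
    fun_prop
  choose L hL using fun T => hR.exists_bound_of_continuousOn (h_cont T).continuousOn
  refine ⟨∑ T, |L T|, fun T x hx => ?_⟩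
  calc |sobolPartial c G T x| ≤ |L T| :=
        (h_bound T x).trans ((le_abs_self _).trans ((hL T x hx).trans (le_abs_self _)))
    _ ≤ ∑ T, |L T| := Finset.single_le_sum (fun T _ => abs_nonneg (L T)) (Finset.mem_univ T)

theorem sobolPartial_sub_update (hG : ∀ w, Measurable (G w)) (hK : ∀ w x, |G w x| ≤ K)
    {T : Finset ι} {p : ι} (hp : p ∉ T) (x : ι → ℝ) (r : ℝ) :
    sobolPartial c G T x - sobolPartial c G T (Function.update x p r) =
      ∫ t in r..(x p), sobolPartial c G (insert p T) (Function.update x p t) := by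
  have hG' w : Measurable fun z => G w (w.piecewise z c) :=
    (hG w).comp (continuous_piecewise_left w c).measurable
  unfold sobolPartial
  rw [← Finset.sum_sub_distrib, intervalIntegral.integral_finsetSum fun w _ =>
    intervalIntegrable_partialIntegral c (hG' w) (fun _ => hK w _) x r (x p)]
  exact Finset.sum_congr rfl fun w _ => partialIntegral_sub_update c (hG' w) (fun _ => hK w _)
    (fun q hq z t => by rw [piecewise_update_of_notMem hq]) hp x r

theorem isIntegralFamily_indicator_sobolPartial (hG : ∀ w, Measurable (G w))
    (hK : ∀ w x, |G w x| ≤ K) {R : Set (ι → ℝ)} (hR : IsCompact R) :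
    IsIntegralFamily R fun T => R.indicator (sobolPartial c G T) where
  measurable T := (measurable_sobolPartial c hG T).indicator hR.measurableSet
  exists_bound := by
    obtain ⟨L, hL⟩ := exists_bound_sobolPartial c hK hR
    refine ⟨|L|, fun T x => ?_⟩
    by_cases hx : x ∈ R
    · rw [indicator_of_mem hx]
      exact (hL T x hx).trans (le_abs_self L)
    · rw [indicator_of_notMem hx, abs_zero]
      exact abs_nonneg L
  sub_eq_integral T p hp x hx r hr := by
    rw [indicator_of_mem hx, indicator_of_mem (hr r left_mem_uIcc),
      sobolPartial_sub_update c hG hK hp]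
    exact intervalIntegral.integral_congr fun t ht => (indicator_of_mem (hr t ht) _).symm

variable {c} {A : Set (ι → ℝ)}

theorem IsIntegralFamily.sobolPartial_empty_eqOn (h : IsIntegralFamily A G)
    (hA : ∀ z ∈ A, {y : ι → ℝ | ∀ p, y p ∈ uIcc (c p) (z p)} ⊆ A) :
    EqOn (sobolPartial c G ∅) (G ∅) A := by
  intro x hx
  rw [sobolPartial_empty, h.eq_sum_anchoredTerm hA Finset.univ ∅ (Finset.disjoint_empty_left _) x
    hx, Finset.powerset_univ]
  refine Finset.sum_congr rfl fun w _ => signedIntegral_congr (fun _ _ => rfl) fun y _ => ?_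
  rw [piecewise_hybrid, Finset.piecewise_univ, Finset.empty_union]

theorem hasDerivAt_sobolPartial {D : Finset ι → (ι → ℝ) → ℝ} (hD : ∀ w, ContinuousOn (D w) A)
    (hG : ∀ w, Measurable (A.indicator (D w))) (hK : ∀ w x, |A.indicator (D w) x| ≤ K)
    {T : Finset ι} {p : ι} (hp : p ∉ T) {x : ι → ℝ} (hx : IsRegularPoint A c (insert p T) x) :
    HasDerivAt (fun t => sobolPartial c (fun w => A.indicator (D w)) T (Function.update x p t))
      (sobolPartial c (fun w => A.indicator (D w)) (insert p T) x) (x p) := by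
  refine HasDerivAt.fun_sum fun w _ => hasDerivAt_partialIntegral c
    ((hG w).comp (continuous_piecewise_left w c).measurable) (fun _ => hK w _)
    (fun q hq z t => ?_) hp ?_
  · simp only [Function.comp_apply, piecewise_update_of_notMem hq]
  · filter_upwards [hx w] with y hy
    exact continuousAt_indicator_comp_piecewise (hD w) hy

end Partials

theorem mixedPartial_sobolPartial_eq {K : ℝ} (hD : ∀ w, ContinuousOn (D w) A)
    (hG : ∀ w, Measurable (A.indicator (D w))) (hK : ∀ w x, |A.indicator (D w) x| ≤ K)
    {x : Pt s d} (hx : ∀ T, IsRegularPoint A c T x) (T : Finset (Fin s × Fin d)) :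
    mixedPartial T (sobolPartial c (fun w => A.indicator (D w)) ∅) x =
      sobolPartial c (fun w => A.indicator (D w)) T x := by
  refine mixedPartial_eqOn (P := fun T => {x | ∀ T' ⊆ T, IsRegularPoint A c T' x})
    (eqOn_refl _ _) (fun v p hp x hx => Filter.Eventually.of_forall fun t v' hv' => ?_)
    (fun v p hp x hx => hasDerivAt_sobolPartial hD hG hK hp (hx _ subset_rfl)) T fun T' _ => hx T'
  exact (hx v' (hv'.trans (Finset.subset_insert p v))).update (fun h => hp (hv' h)) t

end SobolExtension

section SobolBound

variable {s d b : ℕ} {X : Fin s → Set (EuclideanSpace ℝ (Fin d))}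
  (S : ∀ j, RecursiveSplit b (X j)) (u : Finset (Fin s)) (κ : u → ℕ)

theorem ofReal_sigmaSq_le_of_isSobolExtensible (hd : 1 ≤ d) (hb : 2 ≤ b)
    (hX : ∀ j, Bornology.IsBounded (X j)) (h_vol : ∀ j, volume (X j) = 1) {C : ℝ} (hC : 1 ≤ C)
    (h_diam : ∀ j k (t : Fin k → Fin b),
      Metric.diam ((S j).cell k t) ≤ C * (b : ℝ) ^ (-(k : ℝ) / (d : ℝ)))
    {c : Pt s d} (hc : IsSobolExtensible (prodSet X) c) {f : Pt s d → ℝ}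
    (hf : SmoothOn (prodSet X) f) :
    ENNReal.ofReal (sigmaSq S f u κ) ≤
      ENNReal.ofReal ((((2 ^ d - 1) * C ^ d * (2 - 2 / (b : ℝ))) ^ 2) ^ u.card *
        (b : ℝ) ^ (-2 * ((∑ j, κ j : ℕ) : ℝ) / (d : ℝ))) *
        hNorm S u κ (sobolExtension (prodSet X) c (anova X f u)) ^ 2 := by
  have h_cell j := (S j).measurableSet
  have h_meas := measurableSet_prodSet h_cell
  have h_compact : IsCompact (prodSet X) :=
    Metric.isCompact_of_isClosed_isBounded hc.1 (isBounded_prodSet hX)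
  have h_sub := subset_rectHull (isBounded_prodSet hX)
  have hf_int : IntegrableOn f (prodSet X) := hf.continuousOn.integrableOn_compact h_compact
  obtain ⟨D, hD⟩ := smoothOn_iff_exists_hasMixedPartialsOn.1
    (hf.anova h_cell h_vol h_compact hc.ordConnected_update u)
  have hG := hD.isIntegralFamily_indicator h_compact
  obtain ⟨K, hK⟩ := hG.exists_bound
  have h_eq : EqOn ((rectHull (prodSet X)).indicator
      (sobolPartial c (fun w => (prodSet X).indicator (D w)) ∅)) (anova X f u) (prodSet X) :=
    (eqOn_indicator.mono h_sub).trans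
      ((hG.sobolPartial_empty_eqOn hc.2.2.2).trans hD.indicator.eqOn)
  rw [hD.sobolExtension_eq_sobolPartial hc.2.2.2]
  refine ofReal_sigmaSq_le_of_isIntegralFamily S u κ hd hb hX h_vol hC h_diam
    (isIntegralFamily_indicator_sobolPartial c hG.measurable hK isCompact_Icc)
    ((integrableOn_congr_fun h_eq h_meas).2 (integrableOn_anova h_cell h_vol hf_int u))
    (fun τ γ => ?_) fun T => ?_
  · rw [setIntegral_mul_psi_eq_setIntegral_anova_mul_psi S u κ τ γ hb h_vol hf_int]
    exact setIntegral_congr_fun h_meas fun x hx => by simp only [h_eq hx]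
  · filter_upwards [ae_isRegularPoint hc.2.2.2] with x hx hxR
    rw [mixedPartial_sobolPartial_eq hD.continuousOn hG.measurable hK hx, indicator_of_mem hxR]

end SobolBound

theorem CmOn.continuousOn {ι : Type*} [Fintype ι] [DecidableEq ι] {m : ℕ} {A : Set (ι → ℝ)}
    {g : (ι → ℝ) → ℝ} (h : CmOn m A g) : ContinuousOn g A := by
  obtain ⟨D, h_zero, h_cont, -⟩ := h
  exact (h_cont 0 (by simp)).congr h_zero.symm

theorem isCompact_prodSet {s d : ℕ} {X : Fin s → Set (EuclideanSpace ℝ (Fin d))}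
    (hX : ∀ j, Bornology.IsBounded (X j)) (hX_closed : ∀ j, IsClosed (X j)) :
    IsCompact (prodSet X) := by
  refine Metric.isCompact_of_isClosed_isBounded ?_ (isBounded_prodSet hX)
  rw [prodSet_eq_preimage]
  exact (isClosed_set_pi fun j _ => hX_closed j).preimage (continuous_pi continuous_block)

theorem sq_const_pow_le {d b : ℕ} (hd : 1 ≤ d) (hb : 2 ≤ b) (C : ℝ) (n : ℕ) :
    (((2 ^ d - 1) * C ^ d * (2 - 2 / (b : ℝ))) ^ 2) ^ n ≤
      (((d : ℝ) ^ (1 / 2 : ℝ) * (2 ^ d - 1) * C ^ d) ^ 2 * (2 - 2 / (b : ℝ)) ^ 3) ^ n := by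
  have h_ratio := one_le_two_sub_two_div hb
  have h_sqrt : ((d : ℝ) ^ (1 / 2 : ℝ)) ^ 2 = d := by
    rw [← Real.sqrt_eq_rpow, Real.sq_sqrt d.cast_nonneg]
  refine pow_le_pow_left₀ (sq_nonneg _) ?_ n
  calc ((2 ^ d - 1) * C ^ d * (2 - 2 / (b : ℝ))) ^ 2
      = 1 * ((2 ^ d - 1) * C ^ d) ^ 2 * (2 - 2 / (b : ℝ)) ^ 2 := by ring
    _ ≤ d * ((2 ^ d - 1) * C ^ d) ^ 2 * (2 - 2 / (b : ℝ)) ^ 3 := by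
        gcongr
        · exact_mod_cast hd
        · norm_num
    _ = ((d : ℝ) ^ (1 / 2 : ℝ) * (2 ^ d - 1) * C ^ d) ^ 2 * (2 - 2 / (b : ℝ)) ^ 3 := by
        rw [mul_assoc ((d : ℝ) ^ (1 / 2 : ℝ)), mul_pow ((d : ℝ) ^ (1 / 2 : ℝ)), h_sqrt]

end

end ScrambledGeometric

open ScrambledGeometric in
theorem mainTheorem6_general {s d b : ℕ} (hd : 1 ≤ d) (hb : 2 ≤ b)
    {X : Fin s → Set (EuclideanSpace ℝ (Fin d))} (hX_bdd : ∀ j, Bornology.IsBounded (X j))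
    (hX_vol : ∀ j, volume (X j) = 1) (S : ∀ j, RecursiveSplit b (X j)) {C : ℝ} (hC : 1 ≤ C)
    (hdiam : ∀ j k (t : Fin k → Fin b),
      Metric.diam ((S j).cell k t) ≤ C * (b : ℝ) ^ (-(k : ℝ) / (d : ℝ)))
    {f : Pt s d → ℝ} (u : Finset (Fin s)) (κ : u → ℕ) :
    (∀ c : Pt s d, IsSobolExtensible (prodSet X) c → SmoothOn (prodSet X) f →
      ENNReal.ofReal (sigmaSq S f u κ) ≤
        ENNReal.ofReal ((((2 ^ d - 1) * C ^ d * (2 - 2 / (b : ℝ))) ^ 2) ^ u.card *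
          (b : ℝ) ^ (-2 * ((∑ j, κ j : ℕ) : ℝ) / (d : ℝ))) *
          hNorm S u κ (sobolExtension (prodSet X) c (anova X f u)) ^ 2) ∧
    (IntegrableOn f (prodSet X) →
      ∀ F : Pt s d → ℝ, IsCmExtension (s * d) (prodSet X) (anova X f u) F →
        ENNReal.ofReal (sigmaSq S f u κ) ≤
          ENNReal.ofReal ((((2 ^ d - 1) * C ^ d * (2 - 2 / (b : ℝ))) ^ 2) ^ u.card *
            (b : ℝ) ^ (-2 * ((∑ j, κ j : ℕ) : ℝ) / (d : ℝ))) *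
          hNorm S u κ F ^ 2) :=
  ⟨fun _ hc hf => ofReal_sigmaSq_le_of_isSobolExtensible S u κ hd hb hX_bdd hX_vol hC hdiam hc hf,
    fun hf _ hF => ofReal_sigmaSq_le_of_isCmExtension S u κ hd hb hX_bdd hX_vol hC hdiam hf hF⟩

theorem mainTheorem6 (s d b : ℕ) (hd : 1 ≤ d) (hb : 2 ≤ b)
    (X : Fin s → Set (EuclideanSpace ℝ (Fin d)))
    (hX_bdd : ∀ j, Bornology.IsBounded (X j))
    (hX_vol : ∀ j, MeasureTheory.volume (X j) = 1)
    (S : ∀ j, ScrambledGeometric.RecursiveSplit b (X j))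
    (C : ℝ) (hC : 1 ≤ C)
    (hdiam : ∀ j k (t : Fin k → Fin b),
      Metric.diam ((S j).cell k t) ≤ C * (b : ℝ) ^ (-(k : ℝ) / (d : ℝ)))
    (f : ScrambledGeometric.Pt s d → ℝ) (u : Finset (Fin s)) (κ : u → ℕ) :
    (∀ c : ScrambledGeometric.Pt s d,
      ScrambledGeometric.IsSobolExtensible (ScrambledGeometric.prodSet X) c →
      ScrambledGeometric.SmoothOn (ScrambledGeometric.prodSet X) f →
      ENNReal.ofReal (ScrambledGeometric.sigmaSq S f u κ) ≤
        ENNReal.ofReal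
          ((((d : ℝ) ^ (1 / 2 : ℝ) * (2 ^ d - 1) * C ^ d) ^ 2 * (2 - 2 / (b : ℝ)) ^ 3) ^ u.card *
            (b : ℝ) ^ (-2 * ((∑ j, κ j : ℕ) : ℝ) / (d : ℝ))) *
          ScrambledGeometric.hNorm S u κ
            (ScrambledGeometric.sobolExtension (ScrambledGeometric.prodSet X) c
              (ScrambledGeometric.anova X f u)) ^ 2) ∧
    ((∀ j, IsClosed (X j)) → (∀ j, (interior (X j)).Nonempty) →
      (∀ j, MeasureTheory.volume (frontier (X j)) = 0) →
      ScrambledGeometric.CmOn (s * d) (ScrambledGeometric.prodSet X) f →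
      ∀ F : ScrambledGeometric.Pt s d → ℝ,
        ScrambledGeometric.IsCmExtension (s * d) (ScrambledGeometric.prodSet X)
          (ScrambledGeometric.anova X f u) F →
        ENNReal.ofReal (ScrambledGeometric.sigmaSq S f u κ) ≤
          ENNReal.ofReal
            ((((d : ℝ) ^ (1 / 2 : ℝ) * (2 ^ d - 1) * C ^ d) ^ 2 * (2 - 2 / (b : ℝ)) ^ 3) ^ u.card *
              (b : ℝ) ^ (-2 * ((∑ j, κ j : ℕ) : ℝ) / (d : ℝ))) *
            ScrambledGeometric.hNorm S u κ F ^ 2) := by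
  obtain ⟨h_sobol, h_cm⟩ := mainTheorem6_general hd hb hX_bdd hX_vol S hC hdiam (f := f) u κ
  have h_const := ENNReal.ofReal_le_ofReal (mul_le_mul_of_nonneg_right
    (ScrambledGeometric.sq_const_pow_le hd hb C u.card)
    (Real.rpow_nonneg b.cast_nonneg (-2 * ((∑ j, κ j : ℕ) : ℝ) / (d : ℝ))))
  refine ⟨fun c hc hf => (h_sobol c hc hf).trans (mul_le_mul_left h_const _),
    fun hX_closed _ _ hf F hF => (h_cm ?_ F hF).trans (mul_le_mul_left h_const _)⟩
  exact hf.continuousOn.integrableOn_compact (ScrambledGeometric.isCompact_prodSet hX_bdd hX_closed)
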